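/- A permutation pattern is a permutation $p=p_1\cdots p_m$ ($m\ge 1$) in which some pairs of consecutive entries $p_j,p_{j+1}$ may be connected by an underline; the empty pattern $\emptyset$ is also allowed and by convention never occurs. An occurrence of $p$ in a permutation $\pi\in\mathfrak S_n$ is a choice of positions $i_1<\dots<i_m$ such that $\pi_{i_1}\cdots\pi_{i_m}$ is order isomorphic to $p$ and $i_{j+1}=i_j+1$ whenever $p_j,p_{j+1}$ are connected; $p(\pi)$ is the number of occurrences. For a set $A$ of patterns and a pattern $p$ let $$F^{A,p}(t,z)=1+\sum_{n\ge1}\frac{t^n}{n!}\sum_{\pi} z^{p(\pi)},$$ where $\pi$ runs over the permutations in $\mathfrak S_n$ in which no pattern of $A$ occurs. A Stirling permutation of order $n$ is a rearrangement $\sigma$ of the multiset $\{1^2,\dots,n^2\}$ in which all entries between the two occurrences of $i$ are greater than $i$, for each $i$. The block $[i,i]_\sigma$ is the consecutive string between and including the two occurrences of $i$, and $(i,i)_\sigma$ is the string strictly between them. A block has level $1$ if it is contained in no other block; it has level $\ell\ge2$ if it is contained in some level $\ell-1$ block $[j,j]_\sigma$ (its parent) and is contained in no other block of the word $(j,j)_\sigma$.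 Two blocks are siblings if both have level $1$ or they have the same parent. An occurrence of $p$ as a block pattern at level $\ell$ of $\sigma$ is a choice of level $\ell$ blocks $[b_1,b_1]_\sigma,\dots,[b_m,b_m]_\sigma$, appearing from left to right in $\sigma$ and pairwise siblings, such that $b_1\cdots b_m$ is order isomorphic to $p$ and, whenever $p_j,p_{j+1}$ are connected, the second $b_j$ is immediately followed by the first $b_{j+1}$ in $\sigma$. Let $p^{(\ell)}(\sigma)$ be the number of these occurrences and $\mathrm{bl}^{(\ell)}(\sigma)$ the number of level $\ell$ blocks. For a sequence $\mathbf A=(A_1,A_2,\dots)$ of sets of patterns and a sequence $\mathbf p=(p_1,p_2,\dots)$ of patterns let $$G^{\mathbf A,\mathbf p}(t;\mathbf x;\mathbf y)=1+\sum_{n\ge1}\frac{t^n}{n!}\sum_{\sigma}\prod_{i\ge1}x_i^{p_i^{(i)}(\sigma)}y_i^{\mathrm{bl}^{(i)}(\sigma)},$$ where $\sigma$ runs over the Stirling permutations of order $n$ with $a^{(i)}(\sigma)=0$ for all $i\ge1$ and $a\in A_i$. Both are formal power series in $t$, with coefficients in $\mathbb Q[z]$ and $\mathbb Q[x_1,x_2,\dots,y_1,y_2,\dots]$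 respectively. **Corollary 3.** Let $\mathbf A,\mathbf A'$ be sequences of sets of patterns and $\mathbf p,\mathbf p'$ sequences of patterns. (1) If $G^{\mathbf A,\mathbf p}=G^{\mathbf A',\mathbf p'}$, then $F^{A_i,p_i}=F^{A'_i,p'_i}$ for every $i\ge1$ such that none of $A_1,\dots,A_{i-1}$ contains the one-letter pattern $1$ (in particular for every $i\ge1$ if no $A_j$ contains it). (2) Conversely, if $F^{A_i,p_i}=F^{A'_i,p'_i}$ for all $i\ge1$ and there is some $r\ge1$ with $G^{(A_r,A_{r+1},\dots),(p_r,p_{r+1},\dots)}=G^{(A'_r,A'_{r+1},\dots),(p'_r,p'_{r+1},\dots)}$, then $G^{\mathbf A,\mathbf p}=G^{\mathbf A',\mathbf p'}$. -/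

import Mathlib

/-- A permutation pattern: a permutation of `len` letters (in one-line notation
`perm 0, perm 1, …`), some of whose consecutive entries are connected by an underline;
`j ∈ underlined` means that the `j`-th and `(j+1)`-st entries (counted from `0`) are connected.
The case `len = 0` is the empty pattern `∅`, which by convention never occurs, so that avoiding
it is no restriction and counting it counts nothing. -/
structure Pattern where
  len : ℕ
  perm : Equiv.Perm (Fin len)
  underlined : Set (Fin (len - 1))

/-- The pattern `1` of length one. -/
def Pattern.single : Pattern := ⟨1, 1, ∅⟩

/-- The positions `idx 0 < idx 1 < …` form an occurrence of `p` in the word `w`. -/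
def Pattern.OccursAt (p : Pattern) {n : ℕ} {α : Type*} [LinearOrder α] (w : Fin n → α)
    (idx : Fin p.len → Fin n) : Prop :=
  0 < p.len ∧ StrictMono idx ∧
  (∀ j k : Fin p.len, w (idx j) < w (idx k) ↔ p.perm j < p.perm k) ∧
  (∀ j ∈ p.underlined,
    (idx ⟨j + 1, by omega⟩ : ℕ) = (idx ⟨j, by omega⟩ : ℕ) + 1)

open Classical in
/-- The number `p(w)` of occurrences of `p` in the word `w`. -/
noncomputable def Pattern.count (p : Pattern) {n : ℕ} {α : Type*} [LinearOrder α]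
    (w : Fin n → α) : ℕ :=
  (Finset.univ.filter fun idx : Fin p.len → Fin n => p.OccursAt w idx).card

open Classical in
/-- The permutations of `n` letters that avoid every pattern in `A`. -/
noncomputable def avoidingPerms (A : Set Pattern) (n : ℕ) : Finset (Equiv.Perm (Fin n)) :=
  Finset.univ.filter fun π => ∀ a ∈ A, a.count π = 0

/-- The polynomial `∑ z ^ p(π)` over the permutations `π` of `n` letters avoiding `A`. -/
noncomputable def permPoly (A : Set Pattern) (p : Pattern) (n : ℕ) : Polynomial ℚ :=
  ∑ π ∈ avoidingPerms A n, Polynomial.X ^ p.count π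

/-- The generating function `F^{A,p}(t, z)`, a formal power series in `t` over `ℚ[z]`. -/
noncomputable def permEGF (A : Set Pattern) (p : Pattern) : PowerSeries (Polynomial ℚ) :=
  PowerSeries.mk fun n =>
    if n = 0 then 1 else Polynomial.C ((n.factorial : ℚ)⁻¹) * permPoly A p n

/-- `σ` is a Stirling permutation of order `n`: a word of length `2n` in which each of the `n`
letters (here `0, …, n - 1`) occurs exactly twice, and all entries between the two occurrences
of a letter are greater than that letter. -/
def IsStirling {n : ℕ} (σ : Fin (2 * n) → Fin n) : Prop :=
  (∀ i : Fin n, (Finset.univ.filter fun a => σ a = i).card = 2) ∧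
  (∀ a b c : Fin (2 * n), a < b → b < c → σ a = σ c → σ a < σ b)

/-- The block `[i,i]_σ` starts at position `a` and ends at position `b`. -/
def IsBlock {n : ℕ} (σ : Fin (2 * n) → Fin n) (i : Fin n) (a b : Fin (2 * n)) : Prop :=
  a < b ∧ σ a = i ∧ σ b = i

/-- `[i,i]_σ ⊂ [j,j]_σ`. -/
def BlockInside {n : ℕ} (σ : Fin (2 * n) → Fin n) (i j : Fin n) : Prop :=
  i ≠ j ∧ ∃ a b c d, IsBlock σ i a b ∧ IsBlock σ j c d ∧ c ≤ a ∧ b ≤ d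

/-- `[i,i]_σ` is a level `ℓ` block of `σ`. Levels start at `1`. For `ℓ ≥ 2` there has to be a
level `ℓ - 1` block `[j,j]_σ` containing `[i,i]_σ`, such that `[i,i]_σ` is a level `1` block of
the word `(j,j)_σ`, that is, no block inside `[j,j]_σ` contains it. -/
def IsLevelBlock {n : ℕ} (σ : Fin (2 * n) → Fin n) : ℕ → Fin n → Prop
  | 0, _ => False
  | 1, i => ∀ j, ¬ BlockInside σ i j
  | ℓ + 2, i => ∃ j, IsLevelBlock σ (ℓ + 1) j ∧ BlockInside σ i j ∧
      ∀ k, BlockInside σ k j → ¬ BlockInside σ i k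

/-- `[j,j]_σ` is the parent of `[i,i]_σ`. -/
def IsParent {n : ℕ} (σ : Fin (2 * n) → Fin n) (j i : Fin n) : Prop :=
  BlockInside σ i j ∧ ∃ ℓ, IsLevelBlock σ ℓ j ∧ IsLevelBlock σ (ℓ + 1) i

/-- Two blocks are siblings if both have level `1` or they share the same parent. -/
def Siblings {n : ℕ} (σ : Fin (2 * n) → Fin n) (i j : Fin n) : Prop :=
  (IsLevelBlock σ 1 i ∧ IsLevelBlock σ 1 j) ∨ ∃ k, IsParent σ k i ∧ IsParent σ k j

/-- The block `[i,i]_σ` lies to the left of the block `[j,j]_σ`. -/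
def BlockBefore {n : ℕ} (σ : Fin (2 * n) → Fin n) (i j : Fin n) : Prop :=
  ∃ a b c d, IsBlock σ i a b ∧ IsBlock σ j c d ∧ b < c

/-- The last letter of `[i,i]_σ` is immediately followed by the first letter of `[j,j]_σ`. -/
def BlockAdjacent {n : ℕ} (σ : Fin (2 * n) → Fin n) (i j : Fin n) : Prop :=
  ∃ a b c d, IsBlock σ i a b ∧ IsBlock σ j c d ∧ (c : ℕ) = (b : ℕ) + 1

/-- The blocks of the letters `b 0, b 1, …` form an occurrence of `p` as a block pattern at
level `ℓ` in `σ`. -/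
def Pattern.BlockOccursAt (p : Pattern) {n : ℕ} (σ : Fin (2 * n) → Fin n) (ℓ : ℕ)
    (b : Fin p.len → Fin n) : Prop :=
  0 < p.len ∧
  (∀ j, IsLevelBlock σ ℓ (b j)) ∧
  (∀ j k : Fin p.len, j < k → BlockBefore σ (b j) (b k)) ∧
  (∀ j k : Fin p.len, Siblings σ (b j) (b k)) ∧
  (∀ j k : Fin p.len, b j < b k ↔ p.perm j < p.perm k) ∧
  (∀ j ∈ p.underlined, BlockAdjacent σ (b ⟨j, by omega⟩) (b ⟨j + 1, by omega⟩))

open Classical in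
/-- The number of occurrences of `p` as a block pattern at level `ℓ` in `σ`. -/
noncomputable def Pattern.blockCount (p : Pattern) {n : ℕ} (σ : Fin (2 * n) → Fin n)
    (ℓ : ℕ) : ℕ :=
  (Finset.univ.filter fun b : Fin p.len → Fin n => p.BlockOccursAt σ ℓ b).card

open Classical in
/-- The number of level `ℓ` blocks of `σ`. -/
noncomputable def numBlocks {n : ℕ} (σ : Fin (2 * n) → Fin n) (ℓ : ℕ) : ℕ :=
  (Finset.univ.filter fun i : Fin n => IsLevelBlock σ ℓ i).card

/-! A sequence `s₁, s₂, …` indexed by the levels `1, 2, …` is a function on `ℕ` whose value at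
`i` is the entry `s_{i+1}` that belongs to level `i + 1`. -/

open Classical in
/-- The Stirling permutations of order `n` that avoid, at each level, all the patterns given for
that level. -/
noncomputable def avoidingStirling (A : ℕ → Set Pattern) (n : ℕ) :
    Finset (Fin (2 * n) → Fin n) :=
  Finset.univ.filter fun σ =>
    IsStirling σ ∧ ∀ i, ∀ a ∈ A i, a.blockCount σ (i + 1) = 0

/-- Polynomials over `ℚ` in the variables `x₁, x₂, …` (`Sum.inl 0`, `Sum.inl 1`, …) and
`y₁, y₂, …` (`Sum.inr 0`, `Sum.inr 1`, …). -/
abbrev LevelPoly : Type := MvPolynomial (ℕ ⊕ ℕ) ℚ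

/-- The polynomial `∑ ∏ᵢ xᵢ ^ (occurrences of pᵢ at level i) yᵢ ^ (blocks at level i)`, the sum
being over the Stirling permutations of order `n` avoiding `A`. All but finitely many factors of
each product are `1`, as a Stirling permutation has finitely many blocks. -/
noncomputable def stirlingPoly (A : ℕ → Set Pattern) (p : ℕ → Pattern) (n : ℕ) : LevelPoly :=
  ∑ σ ∈ avoidingStirling A n,
    ∏ᶠ i : ℕ, ((MvPolynomial.X (Sum.inl i) : LevelPoly) ^ (p i).blockCount σ (i + 1) *
      (MvPolynomial.X (Sum.inr i) : LevelPoly) ^ numBlocks σ (i + 1))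

/-- The generating function `G^{A,p}(t; x; y)`, a formal power series in `t` over the
polynomials in the `xᵢ` and `yᵢ`. -/
noncomputable def stirlingEGF (A : ℕ → Set Pattern) (p : ℕ → Pattern) : PowerSeries LevelPoly :=
  PowerSeries.mk fun n =>
    if n = 0 then 1 else MvPolynomial.C ((n.factorial : ℚ)⁻¹) * stirlingPoly A p n

/-! The level 1 blocks of a Stirling permutation are juxtaposed, and the letter bounding a block is
its least letter, its root. So a Stirling permutation is an ordered set partition together with, for
each part, a Stirling permutation of the letters other than the minimum. Level 1 patterns see only
the word of roots. Siblings at a deeper level lie inside a common level 1 block, so the deeper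
levels contribute a product over these blocks, each interior counted with its levels lowered by one.
Every order of the parts of a given partition occurs, so the roots run through all arrangements of
`m` distinct letters. Hence, with G' the series of the sequences with their first entries removed
and variables shifted, G(t) = F(y₁ ∫₀ᵗ G'(s) ds, x₁), where F belongs to the first entries. This is
`stirlingPoly_eq`, obtained from `weight_eq_prod`, `wordSum_eq_sum_partitions` and
`factorial_mul_sum_partitions`.

Part (2) follows by applying the formula repeatedly, from the deep levels to the top. For part (1),
setting y₁ = 1 and all other yᵢ = 0 forces empty interiors and turns G into F, so G determines F for
level 1. If the one-letter pattern is not avoided, the linear coefficient of F is nonzero, and the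
coefficients of G' can be solved for recursively (`stirlingPoly_shift_eq`). So G determines G', and
induction reaches every level allowed by the hypothesis. -/

namespace StirlingWord

/-! ### Blocks, levels and siblings in a word `a I a R` -/

section Relations

variable {α : Type*}

/-- The letter `i` stands at the positions `x < y` of the word `l`. -/
def IsBlockAt (l : List α) (i : α) (x y : ℕ) : Prop :=
  x < y ∧ l[x]? = some i ∧ l[y]? = some i

/-- The block of `i` lies inside the block of `j`. -/
def Inside (l : List α) (i j : α) : Prop :=
  i ≠ j ∧ ∃ a b c d, IsBlockAt l i a b ∧ IsBlockAt l j c d ∧ c ≤ a ∧ b ≤ d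

/-- The block of `i` has the given level. -/
def Level (l : List α) : ℕ → α → Prop
  | 0, _ => False
  -- Membership excludes the letters absent from `l`, which lie inside no block.
  | 1, i => i ∈ l ∧ ∀ j, ¬ Inside l i j
  | ℓ + 2, i => ∃ j, Level l (ℓ + 1) j ∧ Inside l i j ∧ ∀ k, Inside l k j → ¬ Inside l i k

/-- The block of `j` is the parent of the block of `i`. -/
def Parent (l : List α) (j i : α) : Prop :=
  Inside l i j ∧ ∃ ℓ, Level l ℓ j ∧ Level l (ℓ + 1) i

/-- The blocks of `i` and `j` are siblings. -/
def Sibling (l : List α) (i j : α) : Prop :=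
  (Level l 1 i ∧ Level l 1 j) ∨ ∃ k, Parent l k i ∧ Parent l k j

/-- The block of `i` lies to the left of the block of `j`. -/
def Before (l : List α) (i j : α) : Prop :=
  ∃ a b c d, IsBlockAt l i a b ∧ IsBlockAt l j c d ∧ b < c

/-- The block of `j` starts right after the block of `i`. -/
def Adjacent (l : List α) (i j : α) : Prop :=
  ∃ a b c d, IsBlockAt l i a b ∧ IsBlockAt l j c d ∧ c = b + 1

/-- The letters `b` form an occurrence of the block pattern `p` at level `ℓ`. -/
def Occurs [LinearOrder α] (p : Pattern) (l : List α) (ℓ : ℕ) (b : Fin p.len → α) : Prop :=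
  0 < p.len ∧
  (∀ j, Level l ℓ (b j)) ∧
  (∀ j k : Fin p.len, j < k → Before l (b j) (b k)) ∧
  (∀ j k : Fin p.len, Sibling l (b j) (b k)) ∧
  (∀ j k : Fin p.len, b j < b k ↔ p.perm j < p.perm k) ∧
  (∀ j ∈ p.underlined, Adjacent l (b ⟨j, by omega⟩) (b ⟨j + 1, by omega⟩))

/-- The number of occurrences of the block pattern `p` at level `ℓ`. -/
noncomputable def occ [LinearOrder α] (p : Pattern) (l : List α) (ℓ : ℕ) : ℕ :=
  Set.ncard {b | Occurs p l ℓ b}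

/-- The number of blocks of level `ℓ`. -/
noncomputable def numLevel (l : List α) (ℓ : ℕ) : ℕ :=
  Set.ncard {i | Level l ℓ i}

/-- The words obtained from the empty word by the construction `I, R ↦ a I a R`, where the
letters of `I` are greater than `a` and no letter is used twice; these are the Stirling
permutations of finite sets. -/
inductive Valid [LT α] : List α → Prop
  | nil : Valid []
  | cons {a : α} {I R : List α} : Valid I → Valid R → (∀ x ∈ I, a < x) → a ∉ R →
      I.Disjoint R → Valid (a :: (I ++ a :: R))

theorem getElem?_split {a i : α} {I R : List α} {k : ℕ} :
    (a :: (I ++ a :: R))[k]? = some i ↔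
      (k = 0 ∧ i = a) ∨ (∃ k', k = k' + 1 ∧ k' < I.length ∧ I[k']? = some i) ∨
      (k = I.length + 1 ∧ i = a) ∨ (∃ k', k = I.length + 2 + k' ∧ R[k']? = some i) := by
  rcases k with _ | k
  · simp [eq_comm]
    omega
  · rw [List.getElem?_cons_succ]
    rcases lt_trichotomy k I.length with h | h | h
    · rw [List.getElem?_append_left h]
      constructor
      · intro h'; exact Or.inr (Or.inl ⟨k, rfl, h, h'⟩)
      · rintro (h' | ⟨k', h1, -, h2⟩ | h' | ⟨k', h1, -⟩)
        · omega
        · obtain rfl : k = k' := by omega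
          exact h2
        · omega
        · omega
    · subst h
      simp only [List.getElem?_append_right le_rfl, Nat.sub_self, List.getElem?_cons_zero,
        Option.some.injEq]
      constructor
      · intro h'; exact Or.inr (Or.inr (Or.inl ⟨trivial, h'.symm⟩))
      · rintro (h' | ⟨k', h1, h3, h2⟩ | h' | ⟨k', h1, -⟩)
        · omega
        · omega
        · exact h'.2.symm
        · omega
    · obtain ⟨m, rfl⟩ : ∃ m, k = I.length + 1 + m := ⟨k - (I.length + 1), by omega⟩
      rw [List.getElem?_append_right (by omega)]
      have : I.length + 1 + m - I.length = m + 1 := by omega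
      rw [this, List.getElem?_cons_succ]
      constructor
      · intro h'; exact Or.inr (Or.inr (Or.inr ⟨m, by omega, h'⟩))
      · rintro (h' | ⟨k', h1, h3, h2⟩ | h' | ⟨k', h1, h2⟩)
        · omega
        · omega
        · omega
        · obtain rfl : m = k' := by omega
          exact h2

theorem IsBlockAt.mem {l : List α} {i : α} {x y : ℕ} (h : IsBlockAt l i x y) : i ∈ l :=
  List.mem_of_getElem? h.2.1

theorem IsBlockAt.lt_length {l : List α} {i : α} {x y : ℕ} (h : IsBlockAt l i x y) :
    y < l.length := by
  obtain ⟨h, -⟩ := List.getElem?_eq_some_iff.1 h.2.2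
  exact h

/-- As `a`, `I` and `R` share no letters, both ends of a block lie in the same factor; the offsets
`1` and `I.length + 2` are where `I` and `R` start. -/
theorem isBlockAt_split {a i : α} {I R : List α} {x y : ℕ} (hI : a ∉ I) (hR : a ∉ R)
    (hd : I.Disjoint R) :
    IsBlockAt (a :: (I ++ a :: R)) i x y ↔
      (i = a ∧ x = 0 ∧ y = I.length + 1) ∨
      (∃ x' y', x = x' + 1 ∧ y = y' + 1 ∧ IsBlockAt I i x' y') ∨
      (∃ x' y', x = I.length + 2 + x' ∧ y = I.length + 2 + y' ∧ IsBlockAt R i x' y') := by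
  constructor
  · rintro ⟨h, hx, hy⟩
    rw [getElem?_split] at hx hy
    rcases hx with ⟨rfl, rfl⟩ | ⟨x', rfl, hx', hx⟩ | ⟨rfl, rfl⟩ | ⟨x', rfl, hx⟩ <;>
    rcases hy with ⟨rfl, h1⟩ | ⟨y', rfl, hy', hy⟩ | ⟨rfl, h1⟩ | ⟨y', rfl, hy⟩
    · omega
    · exact absurd (List.mem_of_getElem? hy) hI
    · exact Or.inl ⟨rfl, rfl, rfl⟩
    · exact absurd (List.mem_of_getElem? hy) hR
    · omega
    · exact Or.inr (Or.inl ⟨x', y', rfl, rfl, by omega, hx, hy⟩)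
    · subst h1; exact absurd (List.mem_of_getElem? hx) hI
    · exact absurd (List.mem_of_getElem? hy) (hd (List.mem_of_getElem? hx))
    · omega
    · omega
    · omega
    · exact absurd (List.mem_of_getElem? hy) hR
    · omega
    · omega
    · omega
    · exact Or.inr (Or.inr ⟨x', y', rfl, rfl, by omega, hx, hy⟩)
  · rintro (⟨rfl, rfl, rfl⟩ | ⟨x', y', rfl, rfl, h⟩ | ⟨x', y', rfl, rfl, h⟩)
    · exact ⟨by omega, getElem?_split.2 (Or.inl ⟨rfl, rfl⟩),
        getElem?_split.2 (Or.inr (Or.inr (Or.inl ⟨rfl, rfl⟩)))⟩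
    · have h1 := h.lt_length
      have h2 := h.1
      exact ⟨by omega, getElem?_split.2 (Or.inr (Or.inl ⟨x', rfl, by omega, h.2.1⟩)),
        getElem?_split.2 (Or.inr (Or.inl ⟨y', rfl, by omega, h.2.2⟩))⟩
    · have h2 := h.1
      exact ⟨by omega, getElem?_split.2 (Or.inr (Or.inr (Or.inr ⟨x', rfl, h.2.1⟩))),
        getElem?_split.2 (Or.inr (Or.inr (Or.inr ⟨y', rfl, h.2.2⟩)))⟩

theorem Valid.exists_block [LT α] {l : List α} (hl : Valid l) {i : α} (hi : i ∈ l) :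
    ∃ x y, IsBlockAt l i x y := by
  induction hl generalizing i with
  | nil => simp at hi
  | @cons a I R _ _ _ _ _ ihI ihR =>
    simp only [List.mem_cons, List.mem_append] at hi
    by_cases h : i = a
    · subst h
      exact ⟨0, I.length + 1, by omega, getElem?_split.2 (Or.inl ⟨rfl, rfl⟩),
        getElem?_split.2 (Or.inr (Or.inr (Or.inl ⟨rfl, rfl⟩)))⟩
    rcases (by tauto : i ∈ I ∨ i ∈ R) with h' | h'
    · obtain ⟨x, y, h⟩ := ihI h'
      have h1 := h.lt_length
      have h2 := h.1
      exact ⟨x + 1, y + 1, by omega,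
        getElem?_split.2 (Or.inr (Or.inl ⟨x, rfl, by omega, h.2.1⟩)),
        getElem?_split.2 (Or.inr (Or.inl ⟨y, rfl, by omega, h.2.2⟩))⟩
    · obtain ⟨x, y, h⟩ := ihR h'
      have h2 := h.1
      exact ⟨I.length + 2 + x, I.length + 2 + y, by omega,
        getElem?_split.2 (Or.inr (Or.inr (Or.inr ⟨x, rfl, h.2.1⟩))),
        getElem?_split.2 (Or.inr (Or.inr (Or.inr ⟨y, rfl, h.2.2⟩)))⟩

theorem Inside.mem_left {l : List α} {i j : α} (h : Inside l i j) : i ∈ l := by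
  obtain ⟨-, _, _, _, _, h, -⟩ := h
  exact h.mem

theorem Inside.mem_right {l : List α} {i j : α} (h : Inside l i j) : j ∈ l := by
  obtain ⟨-, _, _, _, _, -, h, -⟩ := h
  exact h.mem

theorem Level.mem {l : List α} {ℓ : ℕ} {i : α} (h : Level l ℓ i) : i ∈ l := by
  rcases ℓ with _ | _ | ℓ
  · exact h.elim
  · exact h.1
  · obtain ⟨j, -, h, -⟩ := h
    exact h.mem_left

section Split

variable {a i j : α} {I R : List α}

/-- The hypothesis `hb` is what places every letter of `I` inside the outer block: containment needs
two positions of that letter. -/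
theorem inside_split (hI : a ∉ I) (hR : a ∉ R) (hd : I.Disjoint R)
    (hb : ∀ i ∈ I, ∃ x y, IsBlockAt I i x y) :
    Inside (a :: (I ++ a :: R)) i j ↔ (j = a ∧ i ∈ I) ∨ Inside I i j ∨ Inside R i j := by
  constructor
  · rintro ⟨hij, x, y, z, w, h1, h2, h3, h4⟩
    rw [isBlockAt_split hI hR hd] at h1 h2
    rcases h1 with ⟨rfl, rfl, rfl⟩ | ⟨x', y', rfl, rfl, h1⟩ | ⟨x', y', rfl, rfl, h1⟩ <;>
    rcases h2 with ⟨rfl, rfl, rfl⟩ | ⟨z', w', rfl, rfl, h2⟩ | ⟨z', w', rfl, rfl, h2⟩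
    · exact absurd rfl hij
    · omega
    · omega
    · exact Or.inl ⟨rfl, h1.mem⟩
    · exact Or.inr (Or.inl ⟨hij, x', y', z', w', h1, h2, by omega, by omega⟩)
    · have := h1.lt_length
      have := h1.1
      omega
    · omega
    · have := h2.lt_length
      omega
    · exact Or.inr (Or.inr ⟨hij, x', y', z', w', h1, h2, by omega, by omega⟩)
  · rintro (⟨rfl, hi⟩ | ⟨hij, x', y', z', w', h1, h2, h3, h4⟩ |
      ⟨hij, x', y', z', w', h1, h2, h3, h4⟩)
    · obtain ⟨x, y, h⟩ := hb i hi
      have := h.lt_length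
      exact ⟨fun h => hI (h ▸ hi), x + 1, y + 1, 0, I.length + 1,
        (isBlockAt_split hI hR hd).2 (Or.inr (Or.inl ⟨x, y, rfl, rfl, h⟩)),
        (isBlockAt_split hI hR hd).2 (Or.inl ⟨rfl, rfl, rfl⟩), by omega, by omega⟩
    · exact ⟨hij, _, _, _, _,
        (isBlockAt_split hI hR hd).2 (Or.inr (Or.inl ⟨x', y', rfl, rfl, h1⟩)),
        (isBlockAt_split hI hR hd).2 (Or.inr (Or.inl ⟨z', w', rfl, rfl, h2⟩)),
        by omega, by omega⟩
    · exact ⟨hij, _, _, _, _,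
        (isBlockAt_split hI hR hd).2 (Or.inr (Or.inr ⟨x', y', rfl, rfl, h1⟩)),
        (isBlockAt_split hI hR hd).2 (Or.inr (Or.inr ⟨z', w', rfl, rfl, h2⟩)),
        by omega, by omega⟩

/-- A condition on the end of one block and the start of another, invariant under
translation, is inherited by the factors `I` and `R` of `a I a R`. -/
theorem exists_blocks_split_left {Q : ℕ → ℕ → Prop} (hQ : ∀ b c, Q (b + 1) (c + 1) ↔ Q b c)
    (hI : a ∉ I) (hR : a ∉ R) (hd : I.Disjoint R) (hi : i ∈ I) (hj : j ∈ I) :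
    (∃ x b c y, IsBlockAt (a :: (I ++ a :: R)) i x b ∧ IsBlockAt (a :: (I ++ a :: R)) j c y ∧
      Q b c) ↔ ∃ x b c y, IsBlockAt I i x b ∧ IsBlockAt I j c y ∧ Q b c := by
  constructor
  · rintro ⟨x, y, z, w, h1, h2, h⟩
    rw [isBlockAt_split hI hR hd] at h1 h2
    rcases h1 with ⟨rfl, -⟩ | ⟨x', y', rfl, rfl, h1⟩ | ⟨x', y', rfl, rfl, h1⟩
    · exact absurd hi hI
    · rcases h2 with ⟨rfl, -⟩ | ⟨z', w', rfl, rfl, h2⟩ | ⟨z', w', rfl, rfl, h2⟩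
      · exact absurd hj hI
      · exact ⟨x', y', z', w', h1, h2, (hQ _ _).1 h⟩
      · exact absurd h2.mem (hd hj)
    · exact absurd h1.mem (hd hi)
  · rintro ⟨x, y, z, w, h1, h2, h⟩
    exact ⟨_, _, _, _, (isBlockAt_split hI hR hd).2 (Or.inr (Or.inl ⟨x, y, rfl, rfl, h1⟩)),
      (isBlockAt_split hI hR hd).2 (Or.inr (Or.inl ⟨z, w, rfl, rfl, h2⟩)), (hQ _ _).2 h⟩

theorem exists_blocks_split_right {Q : ℕ → ℕ → Prop}
    (hQ : ∀ k b c, Q (k + b) (k + c) ↔ Q b c)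
    (hI : a ∉ I) (hR : a ∉ R) (hd : I.Disjoint R) (hi : i ∈ R) (hj : j ∈ R) :
    (∃ x b c y, IsBlockAt (a :: (I ++ a :: R)) i x b ∧ IsBlockAt (a :: (I ++ a :: R)) j c y ∧
      Q b c) ↔ ∃ x b c y, IsBlockAt R i x b ∧ IsBlockAt R j c y ∧ Q b c := by
  constructor
  · rintro ⟨x, y, z, w, h1, h2, h⟩
    rw [isBlockAt_split hI hR hd] at h1 h2
    rcases h1 with ⟨rfl, -⟩ | ⟨x', y', rfl, rfl, h1⟩ | ⟨x', y', rfl, rfl, h1⟩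
    · exact absurd hi hR
    · exact absurd hi (hd h1.mem)
    · rcases h2 with ⟨rfl, -⟩ | ⟨z', w', rfl, rfl, h2⟩ | ⟨z', w', rfl, rfl, h2⟩
      · exact absurd hj hR
      · exact absurd hj (hd h2.mem)
      · exact ⟨x', y', z', w', h1, h2, (hQ _ _ _).1 h⟩
  · rintro ⟨x, y, z, w, h1, h2, h⟩
    exact ⟨_, _, _, _, (isBlockAt_split hI hR hd).2 (Or.inr (Or.inr ⟨x, y, rfl, rfl, h1⟩)),
      (isBlockAt_split hI hR hd).2 (Or.inr (Or.inr ⟨z, w, rfl, rfl, h2⟩)), (hQ _ _ _).2 h⟩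

theorem before_split_left (hI : a ∉ I) (hR : a ∉ R) (hd : I.Disjoint R) (hi : i ∈ I)
    (hj : j ∈ I) : Before (a :: (I ++ a :: R)) i j ↔ Before I i j :=
  exists_blocks_split_left (Q := fun b c => b < c) (fun _ _ => by omega) hI hR hd hi hj

theorem before_split_right (hI : a ∉ I) (hR : a ∉ R) (hd : I.Disjoint R) (hi : i ∈ R)
    (hj : j ∈ R) : Before (a :: (I ++ a :: R)) i j ↔ Before R i j :=
  exists_blocks_split_right (Q := fun b c => b < c) (fun _ _ _ => by omega) hI hR hd hi hj

theorem adjacent_split_left (hI : a ∉ I) (hR : a ∉ R) (hd : I.Disjoint R) (hi : i ∈ I)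
    (hj : j ∈ I) : Adjacent (a :: (I ++ a :: R)) i j ↔ Adjacent I i j :=
  exists_blocks_split_left (Q := fun b c => c = b + 1) (fun _ _ => by omega) hI hR hd hi hj

theorem adjacent_split_right (hI : a ∉ I) (hR : a ∉ R) (hd : I.Disjoint R) (hi : i ∈ R)
    (hj : j ∈ R) : Adjacent (a :: (I ++ a :: R)) i j ↔ Adjacent R i j :=
  exists_blocks_split_right (Q := fun b c => c = b + 1) (fun _ _ _ => by omega) hI hR hd hi hj

end Split

section LevelSplit

variable {a i j : α} {I R : List α}

theorem level_split_head (hI : a ∉ I) (hR : a ∉ R) (hd : I.Disjoint R)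
    (hb : ∀ i ∈ I, ∃ x y, IsBlockAt I i x y) {ℓ : ℕ} :
    Level (a :: (I ++ a :: R)) ℓ a ↔ ℓ = 1 := by
  have key : ∀ j, ¬ Inside (a :: (I ++ a :: R)) a j := by
    intro j h
    rw [inside_split hI hR hd hb] at h
    rcases h with ⟨-, h⟩ | h | h
    · exact hI h
    · exact hI h.mem_left
    · exact hR h.mem_left
  rcases ℓ with _ | _ | ℓ
  · simp [Level]
  · simp only [Level, key, not_false_eq_true, implies_true, and_true, List.mem_cons, true_or,
      zero_add]
  · simp [Level, key]

theorem inside_split_left (hI : a ∉ I) (hR : a ∉ R) (hd : I.Disjoint R)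
    (hb : ∀ i ∈ I, ∃ x y, IsBlockAt I i x y) (hi : i ∈ I) :
    Inside (a :: (I ++ a :: R)) i j ↔ j = a ∨ Inside I i j := by
  rw [inside_split hI hR hd hb]
  have : ¬ Inside R i j := fun h => hd hi h.mem_left
  tauto

theorem inside_split_right (hI : a ∉ I) (hR : a ∉ R) (hd : I.Disjoint R)
    (hb : ∀ i ∈ I, ∃ x y, IsBlockAt I i x y) (hi : i ∈ R) :
    Inside (a :: (I ++ a :: R)) i j ↔ Inside R i j := by
  rw [inside_split hI hR hd hb]
  have : i ∉ I := fun h => hd h hi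
  have : ¬ Inside I i j := fun h => this h.mem_left
  tauto

/-- The outer block becomes the parent of the level 1 blocks of `I`, which pushes everything in `I`
one level down. -/
theorem level_split_left (hI : a ∉ I) (hR : a ∉ R) (hd : I.Disjoint R)
    (hb : ∀ i ∈ I, ∃ x y, IsBlockAt I i x y) {ℓ : ℕ} (hi : i ∈ I) :
    Level (a :: (I ++ a :: R)) (ℓ + 1) i ↔ Level I ℓ i := by
  have hla : ∀ {ℓ}, Level (a :: (I ++ a :: R)) ℓ a ↔ ℓ = 1 := level_split_head hI hR hd hb
  induction ℓ generalizing i with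
  | zero =>
    simp only [Level, iff_false, not_and, not_forall, not_not]
    exact fun _ => ⟨a, (inside_split_left hI hR hd hb hi).2 (Or.inl rfl)⟩
  | succ ℓ ih =>
    -- Under a parent `j` in `I` no new intermediate block can appear, since the only new block
    -- around `i`, that of `a`, is not inside `j`.
    have hbelow : ∀ {j}, j ∈ I → ((∀ k, Inside (a :: (I ++ a :: R)) k j →
        ¬ Inside (a :: (I ++ a :: R)) i k) ↔ ∀ k, Inside I k j → ¬ Inside I i k) := by
      intro j hj
      have hja : j ≠ a := fun h => hI (h ▸ hj)
      have hjR : ∀ k, ¬ Inside R k j := fun k h => hd hj h.mem_right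
      refine forall_congr' fun k => ?_
      rw [inside_split_left hI hR hd hb hi, inside_split hI hR hd hb]
      constructor
      · intro h h1 h2
        exact h (Or.inr (Or.inl h1)) (Or.inr h2)
      · rintro h (⟨h1, -⟩ | h1 | h1) (rfl | h2)
        · exact hja h1
        · exact hja h1
        · exact hI h1.mem_left
        · exact h h1 h2
        · exact hjR _ h1
        · exact hjR _ h1
    change (∃ j, Level _ (ℓ + 1) j ∧ _ ∧ _) ↔ _
    rcases ℓ with _ | ℓ
    · constructor
      · rintro ⟨j, h1, h2, h3⟩
        rcases (inside_split_left hI hR hd hb hi).1 h2 with rfl | h2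
        · refine ⟨hi, fun k hk => h3 k ?_ ?_⟩
          · exact (inside_split hI hR hd hb).2 (Or.inl ⟨rfl, hk.mem_right⟩)
          · exact (inside_split_left hI hR hd hb hi).2 (Or.inr hk)
        · exact absurd ((ih h2.mem_right).1 h1) id
      · rintro ⟨-, h⟩
        refine ⟨a, hla.2 rfl, (inside_split_left hI hR hd hb hi).2 (Or.inl rfl), ?_⟩
        intro k h1 h2
        rcases (inside_split_left hI hR hd hb hi).1 h2 with rfl | h2
        · exact h1.1 rfl
        · exact h k h2
    · constructor
      · rintro ⟨j, h1, h2, h3⟩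
        rcases (inside_split_left hI hR hd hb hi).1 h2 with rfl | h2
        · have := hla.1 h1
          omega
        · exact ⟨j, (ih h2.mem_right).1 h1, h2, (hbelow h2.mem_right).1 h3⟩
      · rintro ⟨j, h1, h2, h3⟩
        exact ⟨j, (ih h2.mem_right).2 h1, (inside_split_left hI hR hd hb hi).2 (Or.inr h2),
          (hbelow h2.mem_right).2 h3⟩

theorem level_split_right (hI : a ∉ I) (hR : a ∉ R) (hd : I.Disjoint R)
    (hb : ∀ i ∈ I, ∃ x y, IsBlockAt I i x y) {ℓ : ℕ} (hi : i ∈ R) :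
    Level (a :: (I ++ a :: R)) ℓ i ↔ Level R ℓ i := by
  have hR' : ∀ {i j}, i ∈ R → (Inside (a :: (I ++ a :: R)) i j ↔ Inside R i j) :=
    fun hi => inside_split_right hI hR hd hb hi
  have hR'' : ∀ {i j}, j ∈ R → (Inside (a :: (I ++ a :: R)) i j ↔ Inside R i j) := by
    intro i j hj
    rw [inside_split hI hR hd hb]
    have h1 : ¬ Inside I i j := fun h => hd h.mem_right hj
    have h2 : j ≠ a := fun h => hR (h ▸ hj)
    tauto
  rcases ℓ with _ | ℓ
  · rfl
  induction ℓ generalizing i with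
  | zero => simp [Level, hi, hR' hi]
  | succ ℓ ih =>
    refine exists_congr fun j => ?_
    rw [hR' hi]
    constructor
    · rintro ⟨h1, h2, h3⟩
      refine ⟨(ih h2.mem_right).1 h1, h2, fun k hk => ?_⟩
      rw [← hR' hi]
      exact h3 k ((hR' hk.mem_left).2 hk)
    · rintro ⟨h1, h2, h3⟩
      refine ⟨(ih h2.mem_right).2 h1, h2, fun k hk => ?_⟩
      rw [hR' hi]
      exact h3 k ((hR'' h2.mem_right).1 hk)

theorem parent_split_left (hI : a ∉ I) (hR : a ∉ R) (hd : I.Disjoint R)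
    (hb : ∀ i ∈ I, ∃ x y, IsBlockAt I i x y) (hi : i ∈ I) :
    Parent (a :: (I ++ a :: R)) j i ↔ (j = a ∧ Level I 1 i) ∨ Parent I j i := by
  constructor
  · rintro ⟨h, ℓ, h1, h2⟩
    rcases (inside_split_left hI hR hd hb hi).1 h with rfl | h
    · obtain rfl := (level_split_head hI hR hd hb).1 h1
      exact Or.inl ⟨rfl, (level_split_left hI hR hd hb hi).1 h2⟩
    · rcases ℓ with _ | ℓ
      · exact h1.elim
      exact Or.inr ⟨h, ℓ, (level_split_left hI hR hd hb h.mem_right).1 h1,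
        (level_split_left hI hR hd hb hi).1 h2⟩
  · rintro (⟨rfl, h⟩ | ⟨h, ℓ, h1, h2⟩)
    · exact ⟨(inside_split_left hI hR hd hb hi).2 (Or.inl rfl), 1,
        (level_split_head hI hR hd hb).2 rfl, (level_split_left hI hR hd hb hi).2 h⟩
    · exact ⟨(inside_split_left hI hR hd hb hi).2 (Or.inr h), ℓ + 1,
        (level_split_left hI hR hd hb h.mem_right).2 h1,
        (level_split_left hI hR hd hb hi).2 h2⟩

theorem parent_split_right (hI : a ∉ I) (hR : a ∉ R) (hd : I.Disjoint R)
    (hb : ∀ i ∈ I, ∃ x y, IsBlockAt I i x y) (hi : i ∈ R) :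
    Parent (a :: (I ++ a :: R)) j i ↔ Parent R j i := by
  unfold Parent
  rw [inside_split_right hI hR hd hb hi]
  refine and_congr_right fun h => exists_congr fun ℓ => ?_
  rw [level_split_right hI hR hd hb hi, level_split_right hI hR hd hb h.mem_right]

/-- Level 1 blocks of `I`, siblings by convention, remain siblings because they acquire the common
parent `a`. -/
theorem sibling_split_left (hI : a ∉ I) (hR : a ∉ R) (hd : I.Disjoint R)
    (hb : ∀ i ∈ I, ∃ x y, IsBlockAt I i x y) (hi : i ∈ I) (hj : j ∈ I) :
    Sibling (a :: (I ++ a :: R)) i j ↔ Sibling I i j := by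
  unfold Sibling
  rw [level_split_left hI hR hd hb hi]
  simp only [Level, parent_split_left hI hR hd hb hi, parent_split_left hI hR hd hb hj,
    false_and, false_or]
  have hpa : ∀ i, ¬ Parent I a i := fun i h => hI h.1.mem_right
  constructor
  · rintro ⟨k, ⟨rfl, h1⟩ | h1, ⟨h3, h2⟩ | h2⟩
    · exact Or.inl ⟨h1, h2⟩
    · exact absurd h2 (hpa _)
    · subst h3; exact absurd h1 (hpa _)
    · exact Or.inr ⟨k, h1, h2⟩
  · rintro (⟨h1, h2⟩ | ⟨k, h1, h2⟩)
    · exact ⟨a, Or.inl ⟨rfl, h1⟩, Or.inl ⟨rfl, h2⟩⟩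
    · exact ⟨k, Or.inr h1, Or.inr h2⟩

theorem sibling_split_right (hI : a ∉ I) (hR : a ∉ R) (hd : I.Disjoint R)
    (hb : ∀ i ∈ I, ∃ x y, IsBlockAt I i x y) (hi : i ∈ R) (hj : j ∈ R) :
    Sibling (a :: (I ++ a :: R)) i j ↔ Sibling R i j := by
  unfold Sibling
  rw [level_split_right hI hR hd hb hi, level_split_right hI hR hd hb hj]
  simp only [parent_split_right hI hR hd hb hi, parent_split_right hI hR hd hb hj]

/-- A block of `I` has level at least 2 and its parent is `a` or in `I`, whereas a parent of a block
of `R` is in `R`. Hence no occurrence of a pattern straddles `I` and `R`. -/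
theorem not_sibling_split (hI : a ∉ I) (hR : a ∉ R) (hd : I.Disjoint R)
    (hb : ∀ i ∈ I, ∃ x y, IsBlockAt I i x y) (hi : i ∈ I) (hj : j ∈ R) :
    ¬ Sibling (a :: (I ++ a :: R)) i j := by
  rintro (⟨h, -⟩ | ⟨k, h1, h2⟩)
  · exact (level_split_left hI hR hd hb hi).1 h
  · rw [parent_split_right hI hR hd hb hj] at h2
    rcases (parent_split_left hI hR hd hb hi).1 h1 with ⟨rfl, -⟩ | h1
    · exact hR h2.1.mem_right
    · exact hd h1.1.mem_right h2.1.mem_right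

end LevelSplit

end Relations

/-! ### The sequence of level 1 blocks and its roots -/

section Blocks

variable {α : Type*}

/-- The blocks `a I a` of level `1` of a word, from left to right, as pairs `(a, I)`. -/
def blocks [DecidableEq α] : List α → List (α × List α)
  | [] => []
  -- The next copy of `a` closes the block; `tail` drops that copy before continuing.
  | a :: l => (a, l.takeWhile (· ≠ a)) :: blocks (l.dropWhile (· ≠ a)).tail
termination_by l => l.length
decreasing_by
  have := (List.dropWhile_sublist (l := l) (· ≠ a)).length_le
  simp only [List.length_tail, List.length_cons]
  omega

/-- The letters of the blocks of level `1`, from left to right. -/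
def roots [DecidableEq α] (l : List α) : List α := (blocks l).map Prod.fst

@[simp] theorem blocks_nil [DecidableEq α] : blocks ([] : List α) = [] := by
  rw [blocks]

@[simp] theorem roots_nil [DecidableEq α] : roots ([] : List α) = [] := by
  simp [roots]

theorem takeWhile_split [DecidableEq α] {a : α} {I R : List α} (hI : a ∉ I) :
    (I ++ a :: R).takeWhile (· ≠ a) = I := by
  rw [List.takeWhile_append_of_pos (fun x hx => by simpa using ne_of_mem_of_not_mem hx hI)]
  simp

theorem dropWhile_split [DecidableEq α] {a : α} {I R : List α} (hI : a ∉ I) :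
    (I ++ a :: R).dropWhile (· ≠ a) = a :: R := by
  rw [List.dropWhile_append_of_pos (fun x hx => by simpa using ne_of_mem_of_not_mem hx hI)]
  simp

theorem blocks_split [DecidableEq α] {a : α} {I R : List α} (hI : a ∉ I) :
    blocks (a :: (I ++ a :: R)) = (a, I) :: blocks R := by
  rw [blocks, takeWhile_split hI, dropWhile_split hI, List.tail_cons]

theorem roots_split [DecidableEq α] {a : α} {I R : List α} (hI : a ∉ I) :
    roots (a :: (I ++ a :: R)) = a :: roots R := by
  rw [roots, blocks_split hI, List.map_cons, roots]

end Blocks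

/-! ### Pattern and block counts: level 1 through the roots, deeper levels by additivity -/

section Counts

variable {α : Type*} [LinearOrder α]

theorem notMem_of_forall_lt {a : α} {I : List α} (h : ∀ x ∈ I, a < x) : a ∉ I :=
  fun ha => lt_irrefl _ (h a ha)

theorem mem_of_mem_roots {l : List α} (hl : Valid l) {i : α} (h : i ∈ roots l) : i ∈ l := by
  induction hl with
  | nil => simp at h
  | cons _ _ hI _ _ _ ihR =>
    rw [roots_split (notMem_of_forall_lt hI), List.mem_cons] at h
    rcases h with rfl | h
    · simp
    · simp [ihR h]

theorem level_one_iff {l : List α} (hl : Valid l) {i : α} : Level l 1 i ↔ i ∈ roots l := by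
  induction hl with
  | nil => simp [Level]
  | @cons a I R hvI hvR hI hR hd _ ihR =>
    have hI' := notMem_of_forall_lt hI
    have hb : ∀ i ∈ I, ∃ x y, IsBlockAt I i x y := fun i => hvI.exists_block
    rw [roots_split hI', List.mem_cons, ← ihR]
    constructor
    · intro h
      have := h.mem
      rw [List.mem_cons, List.mem_append, List.mem_cons] at this
      by_cases hia : i = a
      · exact Or.inl hia
      rcases (by tauto : i ∈ I ∨ i ∈ R) with h' | h'
      · exact absurd ((level_split_left hI' hR hd hb h').1 h) id
      · exact Or.inr ((level_split_right hI' hR hd hb h').1 h)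
    · rintro (rfl | h)
      · exact (level_split_head hI' hR hd hb).2 rfl
      · exact (level_split_right hI' hR hd hb h.mem).2 h

theorem nodup_roots {l : List α} (hl : Valid l) : (roots l).Nodup := by
  induction hl with
  | nil => simp
  | @cons a I R hvI hvR hI hR hd _ ihR =>
    rw [roots_split (notMem_of_forall_lt hI), List.nodup_cons]
    exact ⟨fun h => hR (mem_of_mem_roots hvR h), ihR⟩

theorem before_roots_iff {l : List α} (hl : Valid l) {x y : ℕ} (hx : x < (roots l).length)
    (hy : y < (roots l).length) : Before l (roots l)[x] (roots l)[y] ↔ x < y := by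
  induction hl generalizing x y with
  | nil => simp at hx
  | @cons a I R hvI hvR hI hR hd _ ihR =>
    have hI' := notMem_of_forall_lt hI
    have hr := roots_split (R := R) hI'
    rw [List.getElem_of_eq hr, List.getElem_of_eq hr]
    rw [hr] at hx hy
    rcases x with _ | x <;> rcases y with _ | y
    · simp only [List.getElem_cons_zero, lt_self_iff_false, iff_false]
      rintro ⟨p, q, r, s, h1, h2, h⟩
      rw [isBlockAt_split hI' hR hd] at h1 h2
      rcases h1 with ⟨-, rfl, rfl⟩ | ⟨p, q, -, -, h1⟩ | ⟨p, q, -, -, h1⟩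
      · rcases h2 with ⟨-, rfl, rfl⟩ | ⟨p, q, -, -, h1⟩ | ⟨p, q, -, -, h1⟩
        · omega
        · exact hI' h1.mem
        · exact hR h1.mem
      · exact hI' h1.mem
      · exact hR h1.mem
    · simp only [List.getElem_cons_zero, List.getElem_cons_succ, Nat.zero_lt_succ, iff_true]
      simp only [List.length_cons, add_lt_add_iff_right] at hy
      obtain ⟨p, q, h⟩ := hvR.exists_block (mem_of_mem_roots hvR (List.getElem_mem hy))
      exact ⟨_, _, _, _, (isBlockAt_split hI' hR hd).2 (Or.inl ⟨rfl, rfl, rfl⟩),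
        (isBlockAt_split hI' hR hd).2 (Or.inr (Or.inr ⟨p, q, rfl, rfl, h⟩)), by omega⟩
    · simp only [List.getElem_cons_zero, List.getElem_cons_succ, Nat.not_lt_zero, iff_false]
      rintro ⟨p, q, r, s, h1, h2, h⟩
      rw [isBlockAt_split hI' hR hd] at h2
      rcases h2 with ⟨-, rfl, rfl⟩ | ⟨p, q, -, -, h1⟩ | ⟨p, q, -, -, h1⟩
      · omega
      · exact hI' h1.mem
      · exact hR h1.mem
    · simp only [List.length_cons, add_lt_add_iff_right] at hx hy
      rw [List.getElem_cons_succ, List.getElem_cons_succ,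
        before_split_right hI' hR hd (mem_of_mem_roots hvR (List.getElem_mem hx))
        (mem_of_mem_roots hvR (List.getElem_mem hy)), ihR hx hy]
      omega

/-- Identifies the block that starts directly after an outer block `a I a`, as needed for adjacency.
-/
theorem Valid.head?_eq {l : List α} (hl : Valid l) : l[0]? = (roots l)[0]? := by
  cases hl with
  | nil => simp
  | cons _ _ hI => simp [roots_split (notMem_of_forall_lt hI)]

theorem adjacent_roots_iff {l : List α} (hl : Valid l) {x y : ℕ} (hx : x < (roots l).length)
    (hy : y < (roots l).length) : Adjacent l (roots l)[x] (roots l)[y] ↔ y = x + 1 := by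
  induction hl generalizing x y with
  | nil => simp at hx
  | @cons a I R hvI hvR hI hR hd _ ihR =>
    have hI' := notMem_of_forall_lt hI
    have hr := roots_split (R := R) hI'
    rw [List.getElem_of_eq hr, List.getElem_of_eq hr]
    rw [hr] at hx hy
    rcases y with _ | y
    · simp only [List.getElem_cons_zero, Nat.zero_ne_add_one, iff_false]
      rintro ⟨p, q, r, s, h1, h2, h⟩
      rw [isBlockAt_split hI' hR hd] at h2
      rcases h2 with ⟨-, rfl, rfl⟩ | ⟨p, q, -, -, h1⟩ | ⟨p, q, -, -, h1⟩
      · omega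
      · exact hI' h1.mem
      · exact hR h1.mem
    rcases x with _ | x
    · simp only [List.length_cons, add_lt_add_iff_right] at hy
      have hyR := mem_of_mem_roots hvR (List.getElem_mem hy)
      simp only [List.getElem_cons_zero, List.getElem_cons_succ, zero_add, Nat.add_eq_right]
      have hhead := hvR.head?_eq
      constructor
      · rintro ⟨p, q, r, s, h1, h2, h⟩
        rw [isBlockAt_split hI' hR hd] at h1 h2
        rcases h1 with ⟨-, rfl, rfl⟩ | ⟨p, q, -, -, h1⟩ | ⟨p, q, -, -, h1⟩
        · rcases h2 with ⟨h2, -⟩ | ⟨p, q, -, -, h1⟩ | ⟨p, q, rfl, rfl, h1⟩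
          · exact absurd (h2 ▸ hyR) hR
          · exact absurd hyR (hd h1.mem)
          -- The second block starts at the first letter of `R`, which is the first root; roots
          -- being distinct, its index is `0`.
          · obtain rfl : p = 0 := by omega
            have h3 := h1.2.1
            rw [hhead, List.getElem?_eq_getElem (by omega), Option.some.injEq,
              (nodup_roots hvR).getElem_inj_iff] at h3
            exact h3.symm
        · exact absurd h1.mem hI'
        · exact absurd h1.mem hR
      · rintro rfl
        have h0 : R[0]? = some (roots R)[0] := by rw [hhead, List.getElem?_eq_getElem]
        cases hvR with
        | nil => simp at hy
        | @cons a' I' R' hvI' hvR' hI'' hR' hd' =>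
          simp only [List.getElem?_cons_zero, Option.some.injEq] at h0
          rw [← h0]
          exact ⟨_, _, _, _, (isBlockAt_split hI' hR hd).2 (Or.inl ⟨rfl, rfl, rfl⟩),
            (isBlockAt_split hI' hR hd).2 (Or.inr (Or.inr ⟨_, _, rfl, rfl,
              (isBlockAt_split (notMem_of_forall_lt hI'') hR' hd').2
                (Or.inl ⟨rfl, rfl, rfl⟩)⟩)), by omega⟩
    · simp only [List.length_cons, add_lt_add_iff_right] at hx hy
      rw [List.getElem_cons_succ, List.getElem_cons_succ,
        adjacent_split_right hI' hR hd (mem_of_mem_roots hvR (List.getElem_mem hx))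
        (mem_of_mem_roots hvR (List.getElem_mem hy)), ihR hx hy]
      omega

/-- The left-to-right order and adjacency of level 1 blocks are those of the roots, and the sibling
condition is automatic. Distinctness of the roots makes the passage from indices to letters
injective. -/
theorem occ_one {l : List α} (hl : Valid l) (p : Pattern) :
    occ p l 1 = p.count (roots l).get := by
  classical
  have himg : {b | Occurs p l 1 b} = (fun idx : Fin p.len → Fin (roots l).length =>
      fun j => (roots l).get (idx j)) '' {idx | p.OccursAt (roots l).get idx} := by
    ext b
    simp only [Set.mem_ofPred_eq, Set.mem_image]
    constructor
    · rintro ⟨h0, hlev, hbef, -, hord, hadj⟩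
      have : ∀ j, ∃ x : Fin (roots l).length, (roots l).get x = b j := fun j =>
        List.mem_iff_get.1 ((level_one_iff hl).1 (hlev j))
      choose idx hidx using this
      refine ⟨idx, ⟨h0, ?_, ?_, ?_⟩, funext hidx⟩
      · intro j k hjk
        have := hbef j k hjk
        rw [← hidx, ← hidx] at this
        exact (before_roots_iff hl _ _).1 this
      · intro j k
        rw [hidx, hidx, hord]
      · intro j hj
        have := hadj j hj
        rw [← hidx, ← hidx] at this
        exact (adjacent_roots_iff hl _ _).1 this
    · rintro ⟨idx, ⟨h0, hmono, hord, hadj⟩, rfl⟩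
      have hlev : ∀ j, Level l 1 ((roots l).get (idx j)) := fun j =>
        (level_one_iff hl).2 (List.get_mem _ _)
      refine ⟨h0, hlev, ?_, fun j k => Or.inl ⟨hlev j, hlev k⟩, hord, ?_⟩
      · intro j k hjk
        exact (before_roots_iff hl _ _).2 (hmono hjk)
      · intro j hj
        exact (adjacent_roots_iff hl _ _).2 (hadj j hj)
  rw [occ, himg, Set.ncard_image_of_injective, Pattern.count, ← Set.ncard_coe_finset]
  · simp
  · intro x y hxy
    funext j
    exact List.nodup_iff_injective_get.1 (nodup_roots hl) (congrFun hxy j)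

theorem numLevel_one {l : List α} (hl : Valid l) : numLevel l 1 = (roots l).length := by
  have : {i | Level l 1 i} = ((roots l).toFinset : Set α) := by
    ext i
    simp [level_one_iff hl]
  rw [numLevel, this, Set.ncard_coe_finset, List.toFinset_card_of_nodup (nodup_roots hl)]

omit [LinearOrder α] in
theorem level_nil {ℓ : ℕ} {i : α} : ¬ Level ([] : List α) ℓ i := fun h => by simpa using h.mem

@[simp] theorem occ_nil (p : Pattern) (ℓ : ℕ) : occ p ([] : List α) ℓ = 0 := by
  have : {b | Occurs p ([] : List α) ℓ b} = ∅ := by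
    ext b
    simp only [Set.mem_ofPred_eq, Set.mem_empty_iff_false, iff_false]
    rintro ⟨h0, h, -⟩
    exact level_nil (h ⟨0, h0⟩)
  rw [occ, this, Set.ncard_empty]

omit [LinearOrder α] in
@[simp] theorem numLevel_nil (ℓ : ℕ) : numLevel ([] : List α) ℓ = 0 := by
  have : {i | Level ([] : List α) ℓ i} = ∅ := by
    ext b
    simp [level_nil]
  rw [numLevel, this, Set.ncard_empty]

variable {a : α} {I R : List α}

theorem level_split (hvI : Valid I) (hI : ∀ x ∈ I, a < x) (hR : a ∉ R) (hd : I.Disjoint R)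
    {ℓ : ℕ} {i : α} :
    Level (a :: (I ++ a :: R)) (ℓ + 2) i ↔ Level I (ℓ + 1) i ∨ Level R (ℓ + 2) i := by
  have hI' := notMem_of_forall_lt hI
  have hb : ∀ i ∈ I, ∃ x y, IsBlockAt I i x y := fun i => hvI.exists_block
  constructor
  · intro h
    have hm := h.mem
    rw [List.mem_cons, List.mem_append, List.mem_cons] at hm
    by_cases hia : i = a
    · subst hia
      have := (level_split_head hI' hR hd hb).1 h
      omega
    rcases (by tauto : i ∈ I ∨ i ∈ R) with h' | h'
    · exact Or.inl ((level_split_left hI' hR hd hb h').1 h)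
    · exact Or.inr ((level_split_right hI' hR hd hb h').1 h)
  · rintro (h | h)
    · exact (level_split_left hI' hR hd hb h.mem).2 h
    · exact (level_split_right hI' hR hd hb h.mem).2 h

variable [Finite α]

theorem numLevel_split (hvI : Valid I) (hI : ∀ x ∈ I, a < x) (hR : a ∉ R)
    (hd : I.Disjoint R) (ℓ : ℕ) :
    numLevel (a :: (I ++ a :: R)) (ℓ + 2) = numLevel I (ℓ + 1) + numLevel R (ℓ + 2) := by
  rw [numLevel, numLevel, numLevel, ← Set.ncard_union_eq]
  · congr 1
    ext i
    exact level_split hvI hI hR hd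
  · rw [Set.disjoint_left]
    exact fun i h1 h2 => hd (Level.mem h1) (Level.mem h2)

/-- The letters of an occurrence are pairwise siblings, so all lie in `I` or all in `R`, where every
defining relation is inherited. Finiteness of `α` makes `Set.ncard` additive. -/
theorem occ_split (hvI : Valid I) (hI : ∀ x ∈ I, a < x) (hR : a ∉ R)
    (hd : I.Disjoint R) (p : Pattern) (ℓ : ℕ) :
    occ p (a :: (I ++ a :: R)) (ℓ + 2) = occ p I (ℓ + 1) + occ p R (ℓ + 2) := by
  have hI' := notMem_of_forall_lt hI
  have hb : ∀ i ∈ I, ∃ x y, IsBlockAt I i x y := fun i => hvI.exists_block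
  rw [occ, occ, occ, ← Set.ncard_union_eq]
  · congr 1
    ext b
    simp only [Set.mem_ofPred_eq, Set.mem_union]
    have left : (∀ j, b j ∈ I) → (Occurs p (a :: (I ++ a :: R)) (ℓ + 2) b ↔
        Occurs p I (ℓ + 1) b) := fun h => by
      simp only [Occurs, level_split_left hI' hR hd hb (h _), before_split_left hI' hR hd (h _)
        (h _), adjacent_split_left hI' hR hd (h _) (h _),
        sibling_split_left hI' hR hd hb (h _) (h _)]
    have right : (∀ j, b j ∈ R) → (Occurs p (a :: (I ++ a :: R)) (ℓ + 2) b ↔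
        Occurs p R (ℓ + 2) b) := fun h => by
      simp only [Occurs, level_split_right hI' hR hd hb (h _),
        before_split_right hI' hR hd (h _) (h _), adjacent_split_right hI' hR hd (h _) (h _),
        sibling_split_right hI' hR hd hb (h _) (h _)]
    constructor
    · intro h
      obtain ⟨h0, hlev, -, hsib, -⟩ := id h
      simp only [level_split hvI hI hR hd] at hlev
      rcases hlev ⟨0, h0⟩ with hm | hm
      · refine Or.inl ((left fun j => ?_).1 h)
        rcases hlev j with hj | hj
        · exact hj.mem
        · exact absurd (hsib ⟨0, h0⟩ j) (not_sibling_split hI' hR hd hb hm.mem hj.mem)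
      · refine Or.inr ((right fun j => ?_).1 h)
        rcases hlev j with hj | hj
        · exact absurd (hsib j ⟨0, h0⟩) (not_sibling_split hI' hR hd hb hj.mem hm.mem)
        · exact hj.mem
    · rintro (h | h)
      · exact (left fun j => (h.2.1 j).mem).2 h
      · exact (right fun j => (h.2.1 j).mem).2 h
  · rw [Set.disjoint_left]
    exact fun b h1 h2 => hd (h1.2.1 ⟨0, h1.1⟩).mem (h2.2.1 ⟨0, h1.1⟩).mem

/-- A crude bound on the depth, used to give the product over all levels finite support; otherwise
`finprod` would take its default value `1`. -/
theorem occ_eq_zero_of_length_lt {l : List α} (hl : Valid l) (p : Pattern) {ℓ : ℕ}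
    (h : l.length < ℓ) : occ p l ℓ = 0 := by
  induction hl generalizing ℓ with
  | nil => simp
  | cons hvI _ hI hR hd ihI ihR =>
    simp only [List.length_cons, List.length_append] at h
    obtain ⟨ℓ, rfl⟩ : ∃ m, ℓ = m + 2 := ⟨ℓ - 2, by omega⟩
    rw [occ_split hvI hI hR hd, ihI (by omega), ihR (by omega)]

theorem numLevel_eq_zero_of_length_lt {l : List α} (hl : Valid l) {ℓ : ℕ}
    (h : l.length < ℓ) : numLevel l ℓ = 0 := by
  induction hl generalizing ℓ with
  | nil => simp
  | cons hvI _ hI hR hd ihI ihR =>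
    simp only [List.length_cons, List.length_append] at h
    obtain ⟨ℓ, rfl⟩ : ∃ m, ℓ = m + 2 := ⟨ℓ - 2, by omega⟩
    rw [numLevel_split hvI hI hR hd, ihI (by omega), ihR (by omega)]

end Counts

/-! ### The weight of a word as a product over its level 1 blocks -/

section Weight

variable {α : Type*} [LinearOrder α]

open Classical in
/-- The weight of a word with respect to the patterns of level `1`. -/
noncomputable def rootWeight (A : Set Pattern) (p : Pattern) (r : List α) : LevelPoly :=
  if ∀ a ∈ A, a.count r.get = 0 then MvPolynomial.X (Sum.inl 0) ^ p.count r.get else 0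

/-- The contribution of the level `i + 1` to the weight of a word. -/
noncomputable def levelFactor (p : Pattern) (l : List α) (i ℓ : ℕ) : LevelPoly :=
  MvPolynomial.X (Sum.inl i) ^ occ p l ℓ * MvPolynomial.X (Sum.inr i) ^ numLevel l ℓ

open Classical in
/-- The weight of a word: its contribution to `stirlingPoly`. -/
noncomputable def weight (A : ℕ → Set Pattern) (p : ℕ → Pattern) (l : List α) : LevelPoly :=
  if ∀ i, ∀ a ∈ A i, occ a l (i + 1) = 0 then ∏ᶠ i, levelFactor (p i) l i (i + 1) else 0

open Classical in
/-- The contribution of the levels greater than `1` to the weight of a word. -/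
noncomputable def innerWeight (A : ℕ → Set Pattern) (p : ℕ → Pattern) (l : List α) :
    LevelPoly :=
  if ∀ i, ∀ a ∈ A (i + 1), occ a l (i + 2) = 0 then
    ∏ᶠ i, levelFactor (p (i + 1)) l (i + 1) (i + 2) else 0

/-- The substitution `x_i ↦ x_{i+1}`, `y_i ↦ y_{i+1}`. -/
noncomputable def shift : LevelPoly →ₐ[ℚ] LevelPoly :=
  MvPolynomial.rename (Sum.map Nat.succ Nat.succ)

theorem shift_injective : Function.Injective shift :=
  MvPolynomial.rename_injective _
    (Sum.map_injective.2 ⟨Nat.succ_injective, Nat.succ_injective⟩)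

theorem finprod_nat_succ {M : Type*} [CommMonoid M] {f : ℕ → M}
    (hf : (Function.mulSupport f).Finite) : ∏ᶠ i, f i = f 0 * ∏ᶠ i, f (i + 1) := by
  obtain ⟨N, hN⟩ := hf.bddAbove
  rw [finprod_eq_prod_of_mulSupport_subset f (s := Finset.range (N + 1)),
    finprod_eq_prod_of_mulSupport_subset (fun i => f (i + 1)) (s := Finset.range N),
    Finset.prod_range_succ', mul_comm]
  · intro i hi
    have := hN (show i + 1 ∈ Function.mulSupport f from hi)
    simp only [Finset.coe_range, Set.mem_Iio]
    omega
  · intro i hi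
    have := hN hi
    simp only [Finset.coe_range, Set.mem_Iio]
    omega

theorem map_levelFactor (p : Pattern) (l : List α) (i ℓ : ℕ) :
    shift (levelFactor p l i ℓ) = levelFactor p l (i + 1) ℓ := by
  simp [shift, levelFactor]

variable [Finite α]

theorem finite_mulSupport_levelFactor {l : List α} (hl : Valid l) (p : ℕ → Pattern)
    (f : ℕ → ℕ) (k : ℕ) :
    (Function.mulSupport fun i => levelFactor (p i) l (f i) (i + k)).Finite := by
  refine (Set.finite_Iic l.length).subset fun i hi => ?_
  by_contra h
  rw [Set.mem_Iic, not_le] at h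
  refine hi ?_
  simp [levelFactor, occ_eq_zero_of_length_lt hl (p i) (show l.length < i + k by omega),
    numLevel_eq_zero_of_length_lt hl (show l.length < i + k by omega)]

/-- Both the avoidance condition and the product over levels separate into level 1, which depends
only on the roots, and the rest. -/
theorem weight_eq_mul_innerWeight {l : List α} (hl : Valid l) (A : ℕ → Set Pattern)
    (p : ℕ → Pattern) :
    weight A p l = rootWeight (A 0) (p 0) (roots l) *
      MvPolynomial.X (Sum.inr 0) ^ (roots l).length * innerWeight A p l := by
  have h1 : (∀ i, ∀ a ∈ A i, occ a l (i + 1) = 0) ↔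
      (∀ a ∈ A 0, a.count (roots l).get = 0) ∧ ∀ i, ∀ a ∈ A (i + 1), occ a l (i + 2) = 0 := by
    constructor
    · intro h
      exact ⟨fun a ha => by rw [← occ_one hl]; exact h 0 a ha, fun i => h (i + 1)⟩
    · rintro ⟨h0, h⟩ (_ | i) a ha
      · rw [occ_one hl]; exact h0 a ha
      · exact h i a ha
  unfold weight rootWeight innerWeight
  rw [finprod_nat_succ (finite_mulSupport_levelFactor hl p (fun i => i) 1)]
  by_cases h : ∀ i, ∀ a ∈ A i, occ a l (i + 1) = 0
  · rw [if_pos h, if_pos (h1.1 h).1, if_pos (h1.1 h).2, levelFactor, occ_one hl,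
      numLevel_one hl]
  · rw [if_neg h]
    by_cases h2 : ∀ a ∈ A 0, a.count (roots l).get = 0
    · rw [if_neg fun h3 => h (h1.2 ⟨h2, h3⟩), mul_zero]
    · rw [if_neg h2, zero_mul, zero_mul]

/-- Counts at levels at least 2 are additive over `I` and `R`, so their monomials multiply. Level `i
+ 2` of the word is level `i + 1` of `I`, whence `shift`. -/
theorem innerWeight_split {a : α} {I R : List α} (hvI : Valid I) (hvR : Valid R)
    (hI : ∀ x ∈ I, a < x) (hR : a ∉ R) (hd : I.Disjoint R) (A : ℕ → Set Pattern)
    (p : ℕ → Pattern) :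
    innerWeight A p (a :: (I ++ a :: R)) =
      shift (weight (fun i => A (i + 1)) (fun i => p (i + 1)) I) * innerWeight A p R := by
  unfold weight innerWeight
  have h1 : (∀ i, ∀ q ∈ A (i + 1), occ q (a :: (I ++ a :: R)) (i + 2) = 0) ↔
      (∀ i, ∀ q ∈ A (i + 1), occ q I (i + 1) = 0) ∧
        ∀ i, ∀ q ∈ A (i + 1), occ q R (i + 2) = 0 := by
    simp only [occ_split hvI hI hR hd, Nat.add_eq_zero_iff, ← forall_and]
  have h2 : ∀ i, levelFactor (p (i + 1)) (a :: (I ++ a :: R)) (i + 1) (i + 2) =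
      shift (levelFactor (p (i + 1)) I i (i + 1)) *
        levelFactor (p (i + 1)) R (i + 1) (i + 2) := by
    intro i
    rw [map_levelFactor, levelFactor, levelFactor, levelFactor, occ_split hvI hI hR hd,
      numLevel_split hvI hI hR hd]
    ring
  have hfin := finite_mulSupport_levelFactor hvI (fun i => p (i + 1)) (fun i => i) 1
  have h3 : ∏ᶠ i, levelFactor (p (i + 1)) (a :: (I ++ a :: R)) (i + 1) (i + 2) =
      shift (∏ᶠ i, levelFactor (p (i + 1)) I i (i + 1)) *
        ∏ᶠ i, levelFactor (p (i + 1)) R (i + 1) (i + 2) := by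
    simp only [h2]
    have h4 := MonoidHom.map_finprod (shift : LevelPoly →* LevelPoly) hfin
    rw [MonoidHom.coe_coe] at h4
    rw [h4]
    simp only [map_levelFactor]
    exact finprod_mul_distrib (finite_mulSupport_levelFactor hvI (fun i => p (i + 1)) _ 1)
      (finite_mulSupport_levelFactor hvR (fun i => p (i + 1)) _ 2)
  rw [h3]
  simp only [h1]
  split_ifs with h h2 h3 <;> first | tauto | simp

theorem innerWeight_eq_prod {l : List α} (hl : Valid l) (A : ℕ → Set Pattern)
    (p : ℕ → Pattern) :
    innerWeight A p l = ((blocks l).map fun q =>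
      shift (weight (fun i => A (i + 1)) (fun i => p (i + 1)) q.2)).prod := by
  induction hl with
  | nil => simp [innerWeight, levelFactor]
  | cons hvI hvR hI hR hd _ ihR =>
    rw [innerWeight_split hvI hvR hI hR hd, blocks_split (notMem_of_forall_lt hI), ihR,
      List.map_cons, List.prod_cons]

/-- The weight of the interior of a block, including the factor for the block itself. -/
noncomputable def blockWeight (A : ℕ → Set Pattern) (p : ℕ → Pattern) (l : List α) :
    LevelPoly :=
  MvPolynomial.X (Sum.inr 0) *
    shift (weight (fun i => A (i + 1)) (fun i => p (i + 1)) l)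

/-- The structural heart of the composition formula. One factor y₁ per root is absorbed into the
weight of its block. -/
theorem weight_eq_prod {l : List α} (hl : Valid l) (A : ℕ → Set Pattern) (p : ℕ → Pattern) :
    weight A p l = rootWeight (A 0) (p 0) (roots l) *
      ((blocks l).map fun q => blockWeight A p q.2).prod := by
  rw [weight_eq_mul_innerWeight hl, innerWeight_eq_prod hl, mul_assoc]
  congr 1
  simp only [blockWeight, List.prod_map_mul, roots, List.length_map]
  simp

end Weight

/-! ### Recursive and positional descriptions of Stirling permutations -/

section Words

variable {α : Type*} [LinearOrder α]

theorem Valid.count_eq {l : List α} (hl : Valid l) (i : α) :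
    l.count i = if i ∈ l then 2 else 0 := by
  induction hl with
  | nil => simp
  | @cons a I R hvI hvR hI hR hd ihI ihR =>
    have hI' := notMem_of_forall_lt hI
    simp only [List.count_cons, List.count_append, ihI, ihR, List.mem_cons, List.mem_append]
    by_cases hia : a = i
    · subst hia
      simp [hI', hR]
    · have h1 : i ∈ I → i ∉ R := fun h => hd h
      have h2 : i ≠ a := Ne.symm hia
      by_cases hiI : i ∈ I
      · simp [hia, hiI, h1 hiI]
      · simp [hia, h2, hiI]

theorem Valid.coe_eq {l : List α} (hl : Valid l) :
    (l : Multiset α) = l.toFinset.val + l.toFinset.val := by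
  ext i
  rw [Multiset.coe_count, hl.count_eq, Multiset.count_add,
    Multiset.count_eq_of_nodup l.toFinset.nodup]
  by_cases h : i ∈ l <;> simp [h]

open Classical in
/-- The Stirling permutations of a finite set. -/
noncomputable def words (S : Finset α) : Finset (List α) :=
  -- The rearrangements of the doubled multiset serve as a finite ambient set; by `Valid.coe_eq`
  -- they include every valid word on `S`.
  (S.val + S.val).lists.toFinset.filter fun l : List α => Valid l ∧ l.toFinset = S

@[simp] theorem mem_words {S : Finset α} {l : List α} :
    l ∈ words S ↔ Valid l ∧ l.toFinset = S := by
  classical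
  simp only [words, Finset.mem_filter, Multiset.mem_toFinset, Multiset.mem_lists_iff,
    and_iff_right_iff_imp]
  rintro ⟨hl, rfl⟩
  exact hl.coe_eq.symm

/-- All entries between two occurrences of a letter are greater than that letter. -/
def Nested (l : List α) : Prop :=
  ∀ (x y z : ℕ) (i j : α), x < y → y < z → l[x]? = some i → l[y]? = some j → l[z]? = some i → i < j

theorem Valid.nested {l : List α} (hl : Valid l) : Nested l := by
  induction hl with
  | nil => intro x y z i j _ _ h; simp at h
  | @cons a I R hvI hvR hI hR hd ihI ihR =>
    have hI' := notMem_of_forall_lt hI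
    intro x y z i j hxy hyz hx hy hz
    have hb : IsBlockAt (a :: (I ++ a :: R)) i x z := ⟨hxy.trans hyz, hx, hz⟩
    rw [isBlockAt_split hI' hR hd] at hb
    rw [getElem?_split] at hy
    rcases hb with ⟨rfl, rfl, rfl⟩ | ⟨x', z', rfl, rfl, hb⟩ | ⟨x', z', rfl, rfl, hb⟩
    · rcases hy with h | ⟨y', -, -, h⟩ | h | ⟨y', rfl, -⟩
      · omega
      · exact hI _ (List.mem_of_getElem? h)
      · omega
      · omega
    · have := hb.lt_length
      rcases hy with h | ⟨y', rfl, -, h⟩ | h | ⟨y', rfl, -⟩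
      · omega
      · exact ihI x' y' z' i j (by omega) (by omega) hb.2.1 h hb.2.2
      · omega
      · omega
    · rcases hy with h | ⟨y', rfl, hy', h⟩ | h | ⟨y', rfl, h⟩
      · omega
      · omega
      · omega
      · exact ihR x' y' z' i j (by omega) (by omega) hb.2.1 h hb.2.2

/-- Cut at the second copy of the first letter `a`. Nesting gives `a < x` for `x` in `I`; a letter
`x` in both `I` and `R` would have the second `a` between its copies, giving `x < a`. -/
theorem valid_of_nested {l : List α} (hl : Nested l) (hc : ∀ i ∈ l, l.count i = 2) :
    Valid l := by
  induction h : l.length using Nat.strong_induction_on generalizing l with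
  | _ n ih =>
  subst h
  rcases l with _ | ⟨a, l⟩
  · exact Valid.nil
  have hca := hc a (by simp)
  rw [List.count_cons_self] at hca
  have hal : a ∈ l := List.count_pos_iff.1 (by omega)
  obtain ⟨I, R, rfl⟩ := List.append_of_mem hal
  rw [List.count_append, List.count_cons_self] at hca
  have hI' : a ∉ I := fun h => by have := List.count_pos_iff.2 h; omega
  have hR : a ∉ R := fun h => by have := List.count_pos_iff.2 h; omega
  have posI : ∀ {x i}, I[x]? = some i → (a :: (I ++ a :: R))[x + 1]? = some i := by
    intro x i h
    exact getElem?_split.2 (Or.inr (Or.inl ⟨x, rfl, (List.getElem?_eq_some_iff.1 h).1, h⟩))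
  have posR : ∀ {x i}, R[x]? = some i →
      (a :: (I ++ a :: R))[I.length + 2 + x]? = some i := by
    intro x i h
    exact getElem?_split.2 (Or.inr (Or.inr (Or.inr ⟨x, rfl, h⟩)))
  have pos0 : (a :: (I ++ a :: R))[0]? = some a := rfl
  have pos1 : (a :: (I ++ a :: R))[I.length + 1]? = some a :=
    getElem?_split.2 (Or.inr (Or.inr (Or.inl ⟨rfl, rfl⟩)))
  have hI : ∀ x ∈ I, a < x := by
    intro x hx
    obtain ⟨k, hk⟩ := List.mem_iff_getElem?.1 hx
    have := (List.getElem?_eq_some_iff.1 hk).1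
    exact hl 0 (k + 1) (I.length + 1) a x (by omega) (by omega) pos0 (posI hk) pos1
  have hd : I.Disjoint R := by
    intro x hx hx'
    obtain ⟨k, hk⟩ := List.mem_iff_getElem?.1 hx
    obtain ⟨m, hm⟩ := List.mem_iff_getElem?.1 hx'
    have := (List.getElem?_eq_some_iff.1 hk).1
    exact lt_asymm (hI x hx) (hl (k + 1) (I.length + 1) (I.length + 2 + m) x a (by omega)
      (by omega) (posI hk) pos1 (posR hm))
  have hcount : ∀ i, i ≠ a → (a :: (I ++ a :: R)).count i = I.count i + R.count i := by
    intro i hi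
    simp [List.count_append, Ne.symm hi]
  refine Valid.cons (ih _ ?_ ?_ ?_ rfl) (ih _ ?_ ?_ ?_ rfl) hI hR hd
  · simp only [List.length_cons, List.length_append]; omega
  · intro x y z i j hxy hyz hx hy hz
    exact hl (x + 1) (y + 1) (z + 1) i j (by omega) (by omega) (posI hx) (posI hy) (posI hz)
  · intro i hi
    have h1 := hc i (by simp [hi])
    rw [hcount i (ne_of_mem_of_not_mem hi hI'), List.count_eq_zero_of_not_mem (hd hi)] at h1
    exact h1
  · simp only [List.length_cons, List.length_append]; omega
  · intro x y z i j hxy hyz hx hy hz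
    exact hl _ _ _ i j (by omega) (by omega) (posR hx) (posR hy) (posR hz)
  · intro i hi
    have h1 := hc i (by simp [hi])
    rw [hcount i (ne_of_mem_of_not_mem hi hR),
      List.count_eq_zero_of_not_mem fun h => hd h hi, zero_add] at h1
    exact h1

end Words

/-! ### Transfer from functions on positions to lists -/

section Bridge

variable {n : ℕ} (σ : Fin (2 * n) → Fin n)

theorem getElem?_ofFn_iff {x : ℕ} {i : Fin n} :
    (List.ofFn σ)[x]? = some i ↔ ∃ h : x < 2 * n, σ ⟨x, h⟩ = i := by
  rw [List.getElem?_eq_some_iff]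
  simp

theorem isBlockAt_ofFn_iff {i : Fin n} {x y : ℕ} :
    IsBlockAt (List.ofFn σ) i x y ↔
      ∃ (hx : x < 2 * n) (hy : y < 2 * n), IsBlock σ i ⟨x, hx⟩ ⟨y, hy⟩ := by
  simp only [IsBlockAt, getElem?_ofFn_iff, IsBlock, Fin.mk_lt_mk]
  constructor
  · rintro ⟨h, ⟨hx, h1⟩, hy, h2⟩
    exact ⟨hx, hy, h, h1, h2⟩
  · rintro ⟨hx, hy, h, h1, h2⟩
    exact ⟨h, ⟨hx, h1⟩, hy, h2⟩

theorem exists_blocks_ofFn {i j : Fin n} {Q : ℕ → ℕ → ℕ → ℕ → Prop} :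
    (∃ a b c d, IsBlockAt (List.ofFn σ) i a b ∧ IsBlockAt (List.ofFn σ) j c d ∧ Q a b c d) ↔
      ∃ a b c d, IsBlock σ i a b ∧ IsBlock σ j c d ∧ Q a b c d := by
  simp only [isBlockAt_ofFn_iff]
  constructor
  · rintro ⟨a, b, c, d, ⟨ha, hb, h1⟩, ⟨hc, hd, h2⟩, h⟩
    exact ⟨_, _, _, _, h1, h2, h⟩
  · rintro ⟨a, b, c, d, h1, h2, h⟩
    exact ⟨a, b, c, d, ⟨a.2, b.2, h1⟩, ⟨c.2, d.2, h2⟩, h⟩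

theorem inside_ofFn {i j : Fin n} : Inside (List.ofFn σ) i j ↔ BlockInside σ i j :=
  and_congr_right fun _ => exists_blocks_ofFn σ (Q := fun a b c d => c ≤ a ∧ b ≤ d)

theorem before_ofFn {i j : Fin n} : Before (List.ofFn σ) i j ↔ BlockBefore σ i j :=
  exists_blocks_ofFn σ (Q := fun _ b c _ => b < c)

theorem adjacent_ofFn {i j : Fin n} : Adjacent (List.ofFn σ) i j ↔ BlockAdjacent σ i j :=
  exists_blocks_ofFn σ (Q := fun _ b c _ => c = b + 1)

variable {σ} (hσ : ∀ i, i ∈ List.ofFn σ)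

include hσ

/-- `hσ` makes the membership condition at level 1 vacuous. -/
theorem level_ofFn {ℓ : ℕ} {i : Fin n} : Level (List.ofFn σ) ℓ i ↔ IsLevelBlock σ ℓ i := by
  rcases ℓ with _ | ℓ
  · rfl
  induction ℓ generalizing i with
  | zero => simp only [Level, IsLevelBlock, hσ, true_and, inside_ofFn]
  | succ ℓ ih =>
    refine exists_congr fun j => ?_
    rw [ih]
    simp only [inside_ofFn]

theorem sibling_ofFn {i j : Fin n} : Sibling (List.ofFn σ) i j ↔ Siblings σ i j := by
  simp only [Sibling, Siblings, Parent, IsParent, level_ofFn hσ, inside_ofFn]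

theorem occ_ofFn (p : Pattern) (ℓ : ℕ) : occ p (List.ofFn σ) ℓ = p.blockCount σ ℓ := by
  classical
  rw [occ, Pattern.blockCount, ← Set.ncard_coe_finset]
  congr 1
  ext b
  rw [Set.mem_ofPred_eq, Finset.mem_coe, Finset.mem_filter]
  simp only [Occurs, Pattern.BlockOccursAt, level_ofFn hσ, sibling_ofFn hσ, before_ofFn,
    adjacent_ofFn, Finset.mem_univ, true_and]

theorem numLevel_ofFn (ℓ : ℕ) : numLevel (List.ofFn σ) ℓ = numBlocks σ ℓ := by
  classical
  rw [numLevel, numBlocks, ← Set.ncard_coe_finset]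
  congr 1
  ext b
  simp only [level_ofFn hσ, Set.mem_ofPred_eq, Finset.mem_coe, Finset.mem_filter,
    Finset.mem_univ, true_and]

end Bridge

theorem count_ofFn {n m : ℕ} (σ : Fin m → Fin n) (i : Fin n) :
    (List.ofFn σ).count i = (Finset.univ.filter fun a => σ a = i).card := by
  rw [← Multiset.coe_count, ← Fin.univ_val_map, Multiset.count_map]
  simp only [eq_comm]
  rfl

theorem nested_ofFn_iff {n : ℕ} (σ : Fin (2 * n) → Fin n) : Nested (List.ofFn σ) ↔
    ∀ a b c : Fin (2 * n), a < b → b < c → σ a = σ c → σ a < σ b := by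
  simp only [Nested, getElem?_ofFn_iff]
  constructor
  · intro h a b c hab hbc hac
    exact h a b c _ _ hab hbc ⟨a.2, rfl⟩ ⟨b.2, rfl⟩ ⟨c.2, hac.symm⟩
  · rintro h x y z i j hxy hyz ⟨hx, rfl⟩ ⟨hy, rfl⟩ ⟨hz, h'⟩
    exact h ⟨x, hx⟩ ⟨y, hy⟩ ⟨z, hz⟩ hxy hyz h'.symm

theorem IsStirling.mem_ofFn {n : ℕ} {σ : Fin (2 * n) → Fin n} (h : IsStirling σ) (i : Fin n) :
    i ∈ List.ofFn σ := by
  rw [← List.count_pos_iff, count_ofFn, h.1]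
  exact Nat.zero_lt_two

theorem isStirling_iff {n : ℕ} (σ : Fin (2 * n) → Fin n) :
    IsStirling σ ↔ List.ofFn σ ∈ words Finset.univ := by
  rw [mem_words]
  constructor
  · intro h
    refine ⟨valid_of_nested ((nested_ofFn_iff σ).2 h.2) fun i _ => ?_, ?_⟩
    · rw [count_ofFn, h.1]
    · ext i
      simpa using (IsStirling.mem_ofFn h i)
  · rintro ⟨h1, h2⟩
    refine ⟨fun i => ?_, (nested_ofFn_iff σ).1 h1.nested⟩
    rw [← count_ofFn, h1.count_eq, if_pos]
    rw [← List.mem_toFinset, h2]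
    exact Finset.mem_univ i

/-- Lists can be cut into factors of varying length, which functions on a fixed `Fin (2 * n)` cannot
conveniently be. -/
theorem stirlingPoly_eq_sum_words (A : ℕ → Set Pattern) (p : ℕ → Pattern) (n : ℕ) :
    stirlingPoly A p n = ∑ l ∈ words (Finset.univ : Finset (Fin n)), weight A p l := by
  classical
  have h : stirlingPoly A p n = ∑ σ ∈ Finset.univ.filter fun σ : Fin (2 * n) → Fin n =>
      IsStirling σ, weight A p (List.ofFn σ) := by
    rw [stirlingPoly, avoidingStirling, ← Finset.filter_filter, Finset.sum_filter]
    refine Finset.sum_congr rfl fun σ hσ => ?_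
    have hσ' := IsStirling.mem_ofFn (Finset.mem_filter.1 hσ).2
    simp only [weight, levelFactor, occ_ofFn hσ', numLevel_ofFn hσ']
  rw [h]
  refine Finset.sum_bij (fun σ _ => List.ofFn σ) ?_ ?_ ?_ ?_
  · intro σ hσ
    exact (isStirling_iff σ).1 (Finset.mem_filter.1 hσ).2
  · intro σ _ τ _ h
    exact List.ofFn_injective h
  · intro l hl
    have hlen : l.length = 2 * n := by
      have h1 := (mem_words.1 hl).1.coe_eq
      rw [(mem_words.1 hl).2] at h1
      have h2 := congrArg Multiset.card h1
      simp at h2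
      omega
    obtain ⟨σ, rfl⟩ : ∃ σ : Fin (2 * n) → Fin n, List.ofFn σ = l :=
      ⟨fun i => l[i.val], by
        apply List.ext_getElem
        · simp [hlen]
        · simp⟩
    exact ⟨σ, by simpa using (isStirling_iff σ).2 hl, rfl⟩
  · intros
    rfl

/-! ### Order isomorphism and sums over all arrangements of the roots -/

section Count

variable {α β : Type*} [LinearOrder α] [LinearOrder β]

theorem count_congr (p : Pattern) {m : ℕ} {v : Fin m → α} {w : Fin m → β}
    (h : ∀ i j, v i < v j ↔ w i < w j) : p.count v = p.count w := by
  classical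
  have key : ∀ idx, p.OccursAt v idx ↔ p.OccursAt w idx := fun idx => by
    simp only [Pattern.OccursAt, h]
  unfold Pattern.count
  congr 1
  ext idx
  rw [Finset.mem_filter, Finset.mem_filter, key]

theorem count_get_ofFn (p : Pattern) {m : ℕ} (w : Fin m → α) :
    p.count (List.ofFn w).get = p.count w := by
  have key : ∀ {l : List α} (hm : l.length = m), (∀ i, l.get i = w (Fin.cast hm i)) →
      p.count l.get = p.count w := by
    rintro l rfl h
    exact congrArg p.count (funext h)
  exact key (List.length_ofFn) fun i => by simp [Fin.cast]

theorem rootWeight_ofFn_congr (A : Set Pattern) (p : Pattern) {m : ℕ} {v : Fin m → α}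
    {w : Fin m → β} (h : ∀ i j, v i < v j ↔ w i < w j) :
    rootWeight A p (List.ofFn v) = rootWeight A p (List.ofFn w) := by
  classical
  simp only [rootWeight, count_get_ofFn, count_congr _ h]

theorem rootWeight_map (A : Set Pattern) (p : Pattern) {f : α → β} (hf : StrictMono f)
    (r : List α) : rootWeight A p (r.map f) = rootWeight A p r := by
  conv_lhs => rw [← List.ofFn_get r, List.map_ofFn]
  conv_rhs => rw [← List.ofFn_get r]
  exact rootWeight_ofFn_congr A p fun i j => hf.lt_iff_lt

/-- The embedding of the polynomials in `z` that sends `z` to `x₁`. -/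
noncomputable def toLevelPoly : Polynomial ℚ →ₐ[ℚ] LevelPoly :=
  Polynomial.aeval (MvPolynomial.X (Sum.inl 0))

/-- If `s` sorts `w`, then `w ∘ τ` is the increasing word `w ∘ s` composed with `s⁻¹ * τ`, so it is
order isomorphic to that permutation; and `s⁻¹ * τ` runs over all permutations with `τ`. -/
theorem sum_rootWeight_perm (A : Set Pattern) (p : Pattern) {m : ℕ} {w : Fin m → α}
    (hw : Function.Injective w) :
    ∑ τ : Equiv.Perm (Fin m), rootWeight A p (List.ofFn (w ∘ τ)) =
      toLevelPoly (permPoly A p m) := by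
  classical
  set s := Tuple.sort w
  have hmono : StrictMono (w ∘ s) :=
    (Tuple.monotone_sort w).strictMono_of_injective (hw.comp s.injective)
  have h1 : ∀ τ : Equiv.Perm (Fin m), rootWeight A p (List.ofFn (w ∘ τ)) =
      rootWeight A p (List.ofFn ⇑(s⁻¹ * τ)) := by
    intro τ
    refine rootWeight_ofFn_congr A p fun i j => ?_
    rw [← hmono.lt_iff_lt]
    simp
  rw [Fintype.sum_congr _ _ h1]
  refine (Equiv.sum_comp (Equiv.mulLeft s⁻¹) fun τ : Equiv.Perm (Fin m) =>
    rootWeight A p (List.ofFn ⇑τ)).trans ?_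
  simp only [permPoly, avoidingPerms, Finset.sum_filter, map_sum, rootWeight, count_get_ofFn]
  refine Finset.sum_congr rfl fun τ _ => ?_
  split_ifs <;> simp [toLevelPoly]

end Count

/-! ### Invariance under increasing relabelling -/

section Relabel

variable {α β : Type*} [LinearOrder α] [LinearOrder β] {f : α → β}

theorem Valid.map (hf : StrictMono f) {l : List α} (hl : Valid l) : Valid (l.map f) := by
  induction hl with
  | nil => exact Valid.nil
  | cons _ _ hI hR hd ihI ihR =>
    rw [List.map_cons, List.map_append, List.map_cons]
    refine Valid.cons ihI ihR ?_ ?_ ?_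
    · intro x hx
      obtain ⟨y, hy, rfl⟩ := List.mem_map.1 hx
      exact hf (hI y hy)
    · rwa [List.mem_map_of_injective hf.injective]
    · intro x hx hx'
      obtain ⟨y, hy, rfl⟩ := List.mem_map.1 hx
      exact hd hy ((List.mem_map_of_injective hf.injective).1 hx')

theorem Valid.of_map (hf : StrictMono f) {l : List α} (hl : Valid (l.map f)) : Valid l := by
  generalize hk : l.map f = k at hl
  induction hl generalizing l with
  | nil => rw [List.map_eq_nil_iff.1 hk]; exact Valid.nil
  | cons _ _ hI hR hd ihI ihR =>
    obtain ⟨a, l₁, rfl, rfl, h₁⟩ := List.map_eq_cons_iff.1 hk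
    obtain ⟨I, l₂, rfl, rfl, h₂⟩ := List.map_eq_append_iff.1 h₁
    obtain ⟨a', R, rfl, ha, rfl⟩ := List.map_eq_cons_iff.1 h₂
    obtain rfl := hf.injective ha
    refine Valid.cons (ihI rfl) (ihR rfl) ?_ ?_ ?_
    · exact fun x hx => hf.lt_iff_lt.1 (hI _ (List.mem_map_of_mem hx))
    · rwa [List.mem_map_of_injective hf.injective] at hR
    · exact fun x hx hx' => hd (List.mem_map_of_mem hx) (List.mem_map_of_mem hx')

theorem blocks_map (hf : StrictMono f) {l : List α} (hl : Valid l) :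
    blocks (l.map f) = (blocks l).map (Prod.map f (List.map f)) := by
  induction hl with
  | nil => simp
  | cons _ _ hI hR hd ihI ihR =>
    have hI' := notMem_of_forall_lt hI
    rw [List.map_cons, List.map_append, List.map_cons, blocks_split hI', blocks_split, ihR]
    · simp
    · rwa [List.mem_map_of_injective hf.injective]

theorem roots_map (hf : StrictMono f) {l : List α} (hl : Valid l) :
    roots (l.map f) = (roots l).map f := by
  rw [roots, blocks_map hf hl, roots, List.map_map, List.map_map]
  rfl

theorem Valid.of_mem_blocks {l : List α} (hl : Valid l) {q : α × List α}
    (hq : q ∈ blocks l) : Valid q.2 ∧ q.2.length < l.length := by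
  induction hl with
  | nil => simp at hq
  | @cons a I R hvI _ hI hR hd ihI ihR =>
    rw [blocks_split (notMem_of_forall_lt hI), List.mem_cons] at hq
    simp only [List.length_cons, List.length_append]
    rcases hq with rfl | hq
    · exact ⟨hvI, by dsimp only; omega⟩
    · exact ⟨(ihR hq).1, by have := (ihR hq).2; omega⟩

/-- By the product formula only the roots and the shorter interiors need comparing. The induction
generalizes `A` and `p` because interiors carry the shifted sequences. -/
theorem weight_map [Finite α] [Finite β] (hf : StrictMono f) (A : ℕ → Set Pattern)
    (p : ℕ → Pattern) {l : List α} (hl : Valid l) :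
    weight A p (l.map f) = weight A p l := by
  induction h : l.length using Nat.strong_induction_on generalizing A p l with
  | _ n ih =>
  rw [weight_eq_prod (hl.map hf), weight_eq_prod hl, roots_map hf hl, rootWeight_map _ _ hf,
    blocks_map hf hl, List.map_map]
  congr 2
  refine List.map_congr_left fun q hq => ?_
  have hq' := hl.of_mem_blocks hq
  simp only [Function.comp, Prod.map, blockWeight]
  rw [ih _ (by omega) _ _ hq'.1 rfl]

theorem sum_words_eq_stirlingPoly [Finite α] (A : ℕ → Set Pattern) (p : ℕ → Pattern)
    (S : Finset α) : ∑ l ∈ words S, weight A p l = stirlingPoly A p S.card := by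
  rw [stirlingPoly_eq_sum_words]
  symm
  set e := S.orderEmbOfFin rfl
  have he : StrictMono e := e.strictMono
  have himg : ∀ l : List (Fin S.card), (l.map e).toFinset = l.toFinset.image e := by
    intro l; ext; simp
  have huniv : (Finset.univ : Finset (Fin S.card)).image e = S := 
    Finset.image_orderEmbOfFin_univ S rfl
  refine Finset.sum_bij (fun l _ => l.map e) ?_ ?_ ?_ ?_
  · intro l hl
    rw [mem_words] at hl ⊢
    exact ⟨hl.1.map he, by rw [himg, hl.2, huniv]⟩
  · intro l _ k _ h
    exact List.map_injective_iff.2 he.injective h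
  · intro l hl
    rw [mem_words] at hl
    have hr : ∀ x ∈ l, x ∈ Set.range e := by
      intro x hx
      rw [Finset.range_orderEmbOfFin, Finset.mem_coe, ← hl.2]
      exact List.mem_toFinset.2 hx
    obtain ⟨k, rfl⟩ : l ∈ Set.range (List.map e) := by
      rw [Set.range_list_map]
      exact hr
    refine ⟨k, mem_words.2 ⟨hl.1.of_map he, ?_⟩, rfl⟩
    apply Finset.image_injective he.injective
    rw [← himg, hl.2, huniv]
  · intro l hl
    exact (weight_map he A p (mem_words.1 hl).1).symm

end Relabel

/-! ### Words as ordered set partitions with filled parts -/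

section Decompose

variable {α : Type*} [LinearOrder α] [Fintype α] {K : Type*} [CommSemiring K]

open Classical in
/-- The possible pairs of the first letter and of the set of the other letters of a block
that belongs to a word with letters in `S`. -/
noncomputable def pieces (S : Finset α) : Finset (α × Finset α) :=
  Finset.univ.filter fun q => q.1 ∈ S ∧ q.2 ⊆ S ∧ ∀ x ∈ q.2, q.1 < x

@[simp] theorem mem_pieces {S : Finset α} {q : α × Finset α} :
    q ∈ pieces S ↔ q.1 ∈ S ∧ q.2 ⊆ S ∧ ∀ x ∈ q.2, q.1 < x := by
  simp [pieces]

/-- A sum over the words with letter set `S` of weights that are multiplicative in the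
blocks of level `1`, except for a factor depending on the sequence of roots. -/
noncomputable def wordSum (φ : List α → K) (u : List α → K) (S : Finset α) : K :=
  ∑ l ∈ words S, φ (roots l) * ((blocks l).map fun q => u q.2).prod

omit [Fintype α] in
theorem words_empty : words (∅ : Finset α) = {[]} := by
  ext l
  rw [mem_words, Finset.mem_singleton, List.toFinset_eq_empty_iff, and_iff_right_iff_imp]
  rintro rfl
  exact Valid.nil

omit [Fintype α] in
theorem wordSum_empty (φ : List α → K) (u : List α → K) : wordSum φ u ∅ = φ [] := by
  simp [wordSum, words_empty]

omit [LinearOrder α] [Fintype α] in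
theorem append_cons_inj_of_notMem {a : α} {I R I' R' : List α} (hI : a ∉ I) (hI' : a ∉ I')
    (h : I ++ a :: R = I' ++ a :: R') : I = I' ∧ R = R' := by
  induction I generalizing I' with
  | nil =>
    cases I' with
    | nil => simpa using h
    | cons b I' =>
      simp only [List.nil_append, List.cons_append, List.cons.injEq] at h
      simp [h.1] at hI'
  | cons b I ih =>
    cases I' with
    | nil =>
      simp only [List.nil_append, List.cons_append, List.cons.injEq] at h
      simp [h.1] at hI
    | cons b' I' =>
      simp only [List.cons_append, List.cons.injEq, List.mem_cons, not_or] at h hI hI'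
      obtain ⟨rfl, h⟩ := h
      simpa using ih hI.2 hI'.2 h

/-- Peel off the first block: `(a, T, I, R) ↦ a I a R` is a bijection, with `T` the letters of `I`.
The removed root is remembered by replacing `φ` with `φ (a :: ·)`, which is why `φ` is arbitrary
here. -/
theorem wordSum_eq_sum_pieces (φ : List α → K) (u : List α → K) {S : Finset α}
    (hS : S.Nonempty) : wordSum φ u S = ∑ q ∈ pieces S, (∑ I ∈ words q.2, u I) *
      wordSum (fun r => φ (q.1 :: r)) u (S \ insert q.1 q.2) := by
  simp only [wordSum, Finset.sum_mul_sum, ← Finset.sum_product']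
  rw [Finset.sum_sigma']
  symm
  refine Finset.sum_bij (fun x _ => x.1.1 :: (x.2.1 ++ x.1.1 :: x.2.2)) ?_ ?_ ?_ ?_
  · rintro ⟨⟨a, T⟩, I, R⟩ hx
    simp only [Finset.mem_sigma, mem_pieces, Finset.mem_product, mem_words] at hx
    obtain ⟨⟨haS, hTS, hT⟩, ⟨hvI, rfl⟩, hvR, hRS⟩ := hx
    have hR : ∀ x, x ∈ R ↔ x ∈ S ∧ ¬ (x = a ∨ x ∈ I) := by
      intro x
      rw [← List.mem_toFinset, hRS]
      simp
    rw [mem_words]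
    refine ⟨Valid.cons hvI hvR (by simpa using hT) ?_ ?_, ?_⟩
    · simp [hR]
    · intro x h1 h2
      simp [hR, h1] at h2
    · ext x
      simp only [List.mem_toFinset, List.mem_cons, List.mem_append, hR]
      have h1 : x ∈ I → x ∈ S := fun h => hTS (List.mem_toFinset.2 h)
      have h2 : x = a → x ∈ S := fun h => h ▸ haS
      tauto
  · rintro ⟨⟨a, T⟩, I, R⟩ hx ⟨⟨a', T'⟩, I', R'⟩ hx' h
    simp only [Finset.mem_sigma, mem_pieces, Finset.mem_product, mem_words] at hx hx'
    obtain ⟨⟨haS, hTS, hT⟩, ⟨hvI, rfl⟩, hvR, hRS⟩ := hx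
    obtain ⟨⟨haS', hTS', hT'⟩, ⟨hvI', rfl⟩, hvR', hRS'⟩ := hx'
    simp only [List.cons.injEq] at h
    obtain ⟨rfl, h⟩ := h
    obtain ⟨rfl, rfl⟩ := append_cons_inj_of_notMem
      (notMem_of_forall_lt (by simpa using hT)) (notMem_of_forall_lt (by simpa using hT')) h
    rfl
  · intro l hl
    rw [mem_words] at hl
    obtain ⟨hv, rfl⟩ := hl
    cases hv with
    | nil => simp at hS
    | @cons a I R hvI hvR hI hR hd =>
      refine ⟨⟨⟨a, I.toFinset⟩, I, R⟩, ?_, rfl⟩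
      simp only [Finset.mem_sigma, mem_pieces, Finset.mem_product, mem_words]
      refine ⟨⟨by simp, fun x hx => ?_, by simpa using hI⟩, ⟨hvI, trivial⟩, hvR, ?_⟩
      · simp only [List.mem_toFinset] at hx
        simp [hx]
      · ext x
        simp only [List.mem_toFinset, Finset.mem_sdiff, List.mem_cons, List.mem_append,
          Finset.mem_insert, not_or]
        have h1 : x ∈ I → x ∉ R := fun h => hd h
        have h2 : x ∈ R → x ≠ a := fun h => ne_of_mem_of_not_mem h hR
        tauto
  · rintro ⟨⟨a, T⟩, I, R⟩ hx
    simp only [Finset.mem_sigma, mem_pieces, Finset.mem_product, mem_words] at hx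
    obtain ⟨⟨haS, hTS, hT⟩, ⟨hvI, rfl⟩, hvR, hRS⟩ := hx
    have hI' : a ∉ I := notMem_of_forall_lt (by simpa using hT)
    rw [roots_split hI', blocks_split hI', List.map_cons, List.prod_cons]
    ring

/-- `P` lists the least letters and the sets of the other letters of the parts of an ordered
set partition of `S`. -/
def IsPartition {m : ℕ} (S : Finset α) (P : Fin m → α × Finset α) : Prop :=
  (∀ i, ∀ x ∈ (P i).2, (P i).1 < x) ∧
  (∀ i j, i ≠ j → Disjoint (insert (P i).1 (P i).2) (insert (P j).1 (P j).2)) ∧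
  ∀ x, x ∈ S ↔ ∃ i, x ∈ insert (P i).1 (P i).2

open Classical in
/-- The ordered partitions of `S` with `m` parts. -/
noncomputable def partitions (m : ℕ) (S : Finset α) : Finset (Fin m → α × Finset α) :=
  Finset.univ.filter fun P => IsPartition S P

@[simp] theorem mem_partitions {m : ℕ} {S : Finset α} {P : Fin m → α × Finset α} :
    P ∈ partitions m S ↔ IsPartition S P := by
  simp [partitions]

theorem isPartition_cons {m : ℕ} {S : Finset α} {q : α × Finset α}
    {P : Fin m → α × Finset α} :
    IsPartition S (Fin.cons q P : Fin (m + 1) → α × Finset α) ↔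
      q ∈ pieces S ∧ IsPartition (S \ insert q.1 q.2) P := by
  rw [mem_pieces]
  unfold IsPartition
  simp only [Fin.forall_fin_succ, Fin.exists_fin_succ, Fin.cons_zero, Fin.cons_succ,
    Finset.mem_sdiff, Finset.disjoint_left, ne_eq, Fin.succ_inj, not_true_eq_false,
    false_imp_iff, true_and, Fin.succ_ne_zero, (Fin.succ_ne_zero _).symm, not_false_eq_true,
    true_imp_iff]
  constructor
  · rintro ⟨⟨h1, h2⟩, ⟨h3, h4⟩, h5⟩
    refine ⟨⟨(h5 _).2 (Or.inl (Finset.mem_insert_self _ _)),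
      fun x hx => (h5 x).2 (Or.inl (Finset.mem_insert_of_mem hx)), h1⟩, h2,
      fun i => (h4 i).2, fun x => ?_⟩
    rw [h5]
    constructor
    · tauto
    · rintro ⟨i, hi⟩
      exact ⟨Or.inr ⟨i, hi⟩, fun h => h3 i h hi⟩
  · rintro ⟨⟨h1, h2, h3⟩, h4, h5, h6⟩
    refine ⟨⟨h3, h4⟩, ⟨fun i x hx hx' => ((h6 x).2 ⟨i, hx'⟩).2 hx,
      fun i => ⟨fun x hx hx' => ((h6 x).2 ⟨i, hx⟩).2 hx', h5 i⟩⟩, fun x => ?_⟩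
    rw [← h6]
    have : x ∈ insert q.1 q.2 → x ∈ S := by
      rw [Finset.mem_insert]
      rintro (rfl | h)
      · exact h1
      · exact h2 h
    tauto

theorem sum_partitions_succ {m : ℕ} (S : Finset α) (g : (Fin (m + 1) → α × Finset α) → K) :
    ∑ P ∈ partitions (m + 1) S, g P =
      ∑ q ∈ pieces S, ∑ P ∈ partitions m (S \ insert q.1 q.2), g (Fin.cons q P) := by
  rw [Finset.sum_sigma']
  symm
  refine Finset.sum_bij (fun x _ => Fin.cons x.1 x.2) ?_ ?_ ?_ ?_
  · rintro ⟨q, P⟩ h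
    rw [Finset.mem_sigma, mem_partitions] at h
    exact mem_partitions.2 (isPartition_cons.2 h)
  · rintro ⟨q, P⟩ _ ⟨q', P'⟩ _ h
    obtain ⟨rfl, rfl⟩ := Fin.cons_injective2 h
    rfl
  · intro P hP
    rw [mem_partitions, ← Fin.cons_self_tail P, isPartition_cons] at hP
    exact ⟨⟨P 0, Fin.tail P⟩, Finset.mem_sigma.2 ⟨hP.1, mem_partitions.2 hP.2⟩,
      Fin.cons_self_tail P⟩
  · intros
    rfl

theorem sum_partitions_zero (S : Finset α) (g : (Fin 0 → α × Finset α) → K) :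
    ∑ P ∈ partitions 0 S, g P = if S = ∅ then g Fin.elim0 else 0 := by
  have h : ∀ P : Fin 0 → α × Finset α, P ∈ partitions 0 S ↔ S = ∅ := fun P => by
    simp [IsPartition, Finset.eq_empty_iff_forall_notMem]
  split_ifs with hS
  · rw [Finset.eq_univ_iff_forall.2 fun P => (h P).2 hS, Fintype.sum_unique]
    exact congrArg g (Subsingleton.elim _ _)
  · rw [Finset.eq_empty_iff_forall_notMem.2 fun P hP => hS ((h P).1 hP), Finset.sum_empty]

/-- Iterated peeling of blocks, matched with the analogous recursion `sum_partitions_succ`. The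
bound `N` suffices because parts are nonempty. -/
theorem wordSum_eq_sum_partitions (φ : List α → K) (u : List α → K) {S : Finset α} {N : ℕ}
    (hS : S.card ≤ N) : wordSum φ u S = ∑ m ∈ Finset.range (N + 1),
      ∑ P ∈ partitions m S, φ (List.ofFn fun i => (P i).1) *
        ∏ i, ∑ I ∈ words (P i).2, u I := by
  rcases S.eq_empty_or_nonempty with rfl | hne
  · rw [wordSum_empty, Finset.sum_range_succ', Finset.sum_eq_zero, zero_add,
      sum_partitions_zero]
    · simp
    · intro m _
      rw [sum_partitions_succ, Finset.sum_eq_zero]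
      intro q hq
      simp at hq
  induction N generalizing φ S with
  | zero => exact absurd (Finset.card_pos.2 hne) (by omega)
  | succ N ih =>
    -- After peeling, the remaining letter set may be empty, a case that `ih` does not cover.
    have ih' : ∀ (φ : List α → K) (S : Finset α), S.card ≤ N → wordSum φ u S =
        ∑ m ∈ Finset.range (N + 1), ∑ P ∈ partitions m S, φ (List.ofFn fun i => (P i).1) *
          ∏ i, ∑ I ∈ words (P i).2, u I := by
      intro φ S hS
      rcases S.eq_empty_or_nonempty with rfl | hne
      · rw [wordSum_empty, Finset.sum_range_succ', Finset.sum_eq_zero, zero_add,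
          sum_partitions_zero]
        · simp
        · intro m _
          rw [sum_partitions_succ, Finset.sum_eq_zero]
          intro q hq
          simp at hq
      · exact ih φ hS hne
    rw [Finset.sum_range_succ', sum_partitions_zero, if_neg hne.ne_empty, add_zero,
      wordSum_eq_sum_pieces φ u hne]
    simp only [sum_partitions_succ]
    rw [Finset.sum_comm]
    refine Finset.sum_congr rfl fun q hq => ?_
    rw [mem_pieces] at hq
    have hlt : (S \ insert q.1 q.2).card < S.card :=
      Finset.card_lt_card (Finset.ssubset_iff_subset_ne.2 ⟨Finset.sdiff_subset, fun h => by
        have := h ▸ hq.1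
        simp at this⟩)
    rw [ih' _ _ (by omega), Finset.mul_sum]
    refine Finset.sum_congr rfl fun m _ => ?_
    rw [Finset.mul_sum]
    refine Finset.sum_congr rfl fun P _ => ?_
    rw [Fin.prod_univ_succ, List.ofFn_succ]
    simp only [Fin.cons_zero, Fin.cons_succ]
    ring

omit [Fintype α] in
theorem IsPartition.comp_perm {m : ℕ} {S : Finset α} {P : Fin m → α × Finset α}
    (h : IsPartition S P) (τ : Equiv.Perm (Fin m)) : IsPartition S (P ∘ τ) := by
  refine ⟨fun i => h.1 (τ i), fun i j hij => h.2.1 _ _ (τ.injective.ne hij), fun x => ?_⟩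
  rw [h.2.2]
  exact τ.surjective.exists

omit [Fintype α] in
theorem IsPartition.injective {m : ℕ} {S : Finset α} {P : Fin m → α × Finset α}
    (h : IsPartition S P) : Function.Injective fun i => (P i).1 := by
  intro i j hij
  by_contra hne
  have := Finset.disjoint_left.1 (h.2.1 i j hne) (Finset.mem_insert_self _ _)
  exact this (by simp only at hij; rw [hij]; exact Finset.mem_insert_self _ _)

/-- Average over the `m!` reorderings of the parts: the product of the `U` is symmetric, while the
root weights of all arrangements of the distinct roots add up to `permPoly`. -/
theorem factorial_mul_sum_partitions (A : Set Pattern) (p : Pattern) (m : ℕ) (S : Finset α)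
    (U : Finset α → LevelPoly) :
    (m.factorial : LevelPoly) * ∑ P ∈ partitions m S,
        rootWeight A p (List.ofFn fun i => (P i).1) * ∏ i, U (P i).2 =
      toLevelPoly (permPoly A p m) * ∑ P ∈ partitions m S, ∏ i, U (P i).2 := by
  have h1 : ∀ τ : Equiv.Perm (Fin m), ∑ P ∈ partitions m S,
        rootWeight A p (List.ofFn fun i => (P i).1) * ∏ i, U (P i).2 =
      ∑ P ∈ partitions m S,
        rootWeight A p (List.ofFn ((fun i => (P i).1) ∘ τ)) * ∏ i, U (P i).2 := by
    intro τ
    symm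
    refine Finset.sum_bij (fun P _ => P ∘ τ) ?_ ?_ ?_ ?_
    · intro P hP
      rw [mem_partitions] at hP ⊢
      exact hP.comp_perm τ
    · intro P _ Q _ h
      exact τ.surjective.injective_comp_right h
    · intro P hP
      rw [mem_partitions] at hP
      refine ⟨P ∘ ⇑τ⁻¹, mem_partitions.2 (hP.comp_perm _), ?_⟩
      funext i
      simp
    · intro P _
      congr 1
      exact (Equiv.prod_comp τ fun i => U (P i).2).symm
  calc _ = ∑ τ : Equiv.Perm (Fin m), ∑ P ∈ partitions m S,
        rootWeight A p (List.ofFn fun i => (P i).1) * ∏ i, U (P i).2 := by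
        rw [Finset.sum_const, Finset.card_univ, Fintype.card_perm, Fintype.card_fin,
          nsmul_eq_mul]
    _ = ∑ P ∈ partitions m S, ∑ τ : Equiv.Perm (Fin m),
        rootWeight A p (List.ofFn ((fun i => (P i).1) ∘ τ)) * ∏ i, U (P i).2 :=
        (Finset.sum_congr rfl fun τ _ => h1 τ).trans Finset.sum_comm
    _ = _ := by
        rw [Finset.mul_sum]
        refine Finset.sum_congr rfl fun P hP => ?_
        rw [← Finset.sum_mul, sum_rootWeight_perm A p (mem_partitions.1 hP).injective]

end Decompose

/-! ### The composition formula -/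

section Formula

/-- The sum, over the ordered set partitions of `n` letters with `m` parts, of the products of
the `c k`, where `k + 1` runs over the sizes of the parts. -/
noncomputable def partitionSum {K : Type*} [CommSemiring K] (m n : ℕ) (c : ℕ → K) : K :=
  ∑ P ∈ partitions m (Finset.univ : Finset (Fin n)), ∏ i, c (P i).2.card

theorem map_partitionSum {K L : Type*} [CommSemiring K] [CommSemiring L] (f : K →+* L)
    (m n : ℕ) (c : ℕ → K) : f (partitionSum m n c) = partitionSum m n fun k => f (c k) := by
  simp [partitionSum]

/-- The composition formula `G = F (y₁ ∫ G')`, in terms of coefficients. -/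
theorem stirlingPoly_eq (A : ℕ → Set Pattern) (p : ℕ → Pattern) (n : ℕ) :
    stirlingPoly A p n = ∑ m ∈ Finset.range (n + 1),
      MvPolynomial.C ((m.factorial : ℚ)⁻¹) * toLevelPoly (permPoly (A 0) (p 0) m) *
        partitionSum m n fun k => MvPolynomial.X (Sum.inr 0) *
          shift (stirlingPoly (fun i => A (i + 1)) (fun i => p (i + 1)) k) := by
  have h1 : stirlingPoly A p n = wordSum (rootWeight (A 0) (p 0)) (blockWeight A p)
      (Finset.univ : Finset (Fin n)) := by
    rw [stirlingPoly_eq_sum_words, wordSum]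
    exact Finset.sum_congr rfl fun l hl => weight_eq_prod (mem_words.1 hl).1 A p
  have h2 : ∀ T : Finset (Fin n), ∑ I ∈ words T, blockWeight A p I =
      MvPolynomial.X (Sum.inr 0) *
        shift (stirlingPoly (fun i => A (i + 1)) (fun i => p (i + 1)) T.card) := by
    intro T
    rw [← sum_words_eq_stirlingPoly, map_sum, Finset.mul_sum]
    rfl
  rw [h1, wordSum_eq_sum_partitions _ _ (N := n) (by simp)]
  refine Finset.sum_congr rfl fun m _ => ?_
  have h3 : (MvPolynomial.C ((m.factorial : ℚ)⁻¹) : LevelPoly) * (m.factorial : LevelPoly) =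
      1 := by
    rw [← map_natCast (MvPolynomial.C : ℚ →+* LevelPoly), ← map_mul,
      inv_mul_cancel₀ (by exact_mod_cast m.factorial_ne_zero), map_one]
  have h4 := factorial_mul_sum_partitions (A 0) (p 0) m (Finset.univ : Finset (Fin n))
    fun T => MvPolynomial.X (Sum.inr 0) *
      shift (stirlingPoly (fun i => A (i + 1)) (fun i => p (i + 1)) T.card)
  simp only [h2, partitionSum]
  rw [mul_assoc, ← h4, ← mul_assoc, h3, one_mul]

end Formula

/-! ### Special values of the partition sums -/

section PartitionSum

variable {K : Type*} [CommSemiring K] {m n : ℕ}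

theorem IsPartition.sum_card {P : Fin m → Fin n × Finset (Fin n)}
    (h : IsPartition Finset.univ P) : ∑ i, ((P i).2.card + 1) = n := by
  have h1 : (Finset.univ : Finset (Fin n)) =
      Finset.univ.biUnion fun i => insert (P i).1 (P i).2 := by
    ext x
    rw [h.2.2, Finset.mem_biUnion]
    simp only [Finset.mem_univ, true_and]
  have h2 := congrArg Finset.card h1
  rw [Finset.card_univ, Fintype.card_fin,
    Finset.card_biUnion fun i _ j _ hij => h.2.1 i j hij] at h2
  refine (Finset.sum_congr rfl fun i _ => ?_).trans h2.symm
  rw [Finset.card_insert_of_notMem fun hi => lt_irrefl _ (h.1 i _ hi)]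

/-- With at least two parts, each part has fewer than `n` letters; with no parts the product is
empty. -/
theorem partitionSum_congr_of_ne_one (hm : m ≠ 1) {c c' : ℕ → K}
    (h : ∀ k, k + 1 < n → c k = c' k) : partitionSum m n c = partitionSum m n c' := by
  refine Finset.sum_congr rfl fun P hP => Finset.prod_congr rfl fun i _ => h _ ?_
  have h1 := (mem_partitions.1 hP).sum_card
  obtain ⟨j, hj⟩ : ∃ j, j ≠ i := by
    have : Nontrivial (Fin m) := Fin.nontrivial_iff_two_le.2 (by have := i.2; omega)
    exact exists_ne i
  have h2 := Finset.single_lt_sum (f := fun i => (P i).2.card + 1) hj (Finset.mem_univ i)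
    (Finset.mem_univ j) (Nat.succ_pos _) (fun _ _ _ => Nat.zero_le _)
  omega

theorem partitionSum_zero_left (hn : n ≠ 0) (c : ℕ → K) : partitionSum 0 n c = 0 := by
  rw [partitionSum, sum_partitions_zero, if_neg]
  have : Nonempty (Fin n) := ⟨⟨0, by omega⟩⟩
  exact Finset.univ_nonempty.ne_empty

theorem partitionSum_zero_zero (c : ℕ → K) : partitionSum 0 0 c = 1 := by
  rw [partitionSum, sum_partitions_zero]
  simp

theorem partitionSum_zero_right (hm : m ≠ 0) : partitionSum m n (fun _ => (0 : K)) = 0 := by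
  refine Finset.sum_eq_zero fun P _ => ?_
  rw [Finset.prod_const, Finset.card_univ, Fintype.card_fin, zero_pow hm]

/-- A single part leaves `k` letters besides its minimum. Only the nonvanishing of `N`, and its
independence of `c`, matter later. -/
theorem partitionSum_one (k : ℕ) : ∃ N : ℕ, N ≠ 0 ∧ ∀ {K : Type} [CommSemiring K] (c : ℕ → K),
    partitionSum 1 (k + 1) c = N * c k := by
  refine ⟨(partitions 1 (Finset.univ : Finset (Fin (k + 1)))).card, ?_, fun c => ?_⟩
  · rw [Finset.card_ne_zero]
    refine ⟨fun _ => (0, Finset.univ.erase 0), mem_partitions.2 ⟨fun _ x hx => ?_, ?_, ?_⟩⟩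
    · exact Fin.pos_iff_ne_zero.2 (Finset.ne_of_mem_erase hx)
    · exact fun i j hij => absurd (Subsingleton.elim i j) hij
    · intro x
      simp
  · rw [← nsmul_eq_mul, ← Finset.sum_const]
    refine Finset.sum_congr rfl fun P hP => ?_
    have h1 := (mem_partitions.1 hP).sum_card
    rw [Fin.sum_univ_one] at h1
    rw [Fin.prod_univ_one]
    congr 1
    omega

/-- Only partitions into singletons survive, which forces `m = n`. Again it matters only that `N` is
a nonzero constant depending on `n` alone. -/
theorem partitionSum_indicator (n : ℕ) : ∃ N : ℕ, N ≠ 0 ∧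
    ∀ {K : Type} [CommSemiring K] (m : ℕ),
      partitionSum m n (fun k => if k = 0 then (1 : K) else 0) =
        if m = n then (N : K) else 0 := by
  refine ⟨(partitions n (Finset.univ : Finset (Fin n))).card, ?_, fun m => ?_⟩
  · rw [Finset.card_ne_zero]
    refine ⟨fun i => (i, ∅), mem_partitions.2 ⟨?_, ?_, ?_⟩⟩
    · simp
    · intro i j hij
      simpa using hij
    · simp
  split_ifs with hmn
  · subst hmn
    rw [← nsmul_one, ← Finset.sum_const]
    refine Finset.sum_congr rfl fun P hP => ?_
    have h1 := (mem_partitions.1 hP).sum_card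
    rw [Finset.sum_add_distrib] at h1
    have h2 : ∑ i, (P i).2.card = 0 := by simpa using h1
    rw [Finset.sum_eq_zero_iff] at h2
    exact Finset.prod_eq_one fun i hi => if_pos (h2 i hi)
  · refine Finset.sum_eq_zero fun P hP => ?_
    have h1 := (mem_partitions.1 hP).sum_card
    by_contra hne
    have h2 : ∀ i, (P i).2.card = 0 := by
      intro i
      by_contra hi
      exact hne (Finset.prod_eq_zero (Finset.mem_univ i) (if_neg hi))
    simp [h2] at h1
    exact hmn h1

end PartitionSum

/-! ### Extracting F and the inner series from G -/

section Coefficients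

/-- No pattern occurs in the empty word, the empty pattern included by convention; this matches the
constant term `1` prescribed in `permEGF`. -/
theorem permPoly_zero (A : Set Pattern) (p : Pattern) : permPoly A p 0 = 1 := by
  classical
  have h : ∀ (q : Pattern) (π : Equiv.Perm (Fin 0)), q.count π = 0 := by
    intro q π
    rw [Pattern.count, Finset.card_eq_zero, Finset.filter_eq_empty_iff]
    rintro idx - ⟨h0, -⟩
    exact (idx ⟨0, h0⟩).elim0
  simp [permPoly, avoidingPerms, h]

/-- Only a pattern of length one can occur in a one-letter word, and such a pattern has no
consecutive entries to underline, so it is `Pattern.single`. This is where the hypothesis on the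
one-letter pattern enters. -/
theorem permPoly_one_ne_zero {A : Set Pattern} (hA : Pattern.single ∉ A) (p : Pattern) :
    permPoly A p 1 ≠ 0 := by
  classical
  have h : ∀ a ∈ A, ∀ π : Equiv.Perm (Fin 1), a.count π = 0 := by
    intro a ha π
    rw [Pattern.count, Finset.card_eq_zero, Finset.filter_eq_empty_iff]
    rintro idx - ⟨h0, hmono, -⟩
    refine hA ?_
    have h1 : a.len = 1 := by
      have := Fintype.card_le_of_injective idx hmono.injective
      simp only [Fintype.card_fin] at this
      omega
    obtain ⟨len, perm, und⟩ := a
    obtain rfl : len = 1 := h1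
    have h2 : perm = 1 := Subsingleton.elim _ _
    have h3 : und = ∅ := Set.eq_empty_of_forall_notMem fun x _ => x.elim0
    rw [h2, h3] at ha
    exact ha
  have h1 : avoidingPerms A 1 = Finset.univ := by
    rw [avoidingPerms, Finset.filter_true_of_mem]
    exact fun π _ a ha => h a ha π
  rw [permPoly, h1, Fintype.sum_unique]
  exact pow_ne_zero _ Polynomial.X_ne_zero

theorem permEGF_eq_iff {A A' : Set Pattern} {p p' : Pattern} :
    permEGF A p = permEGF A' p' ↔ ∀ n, permPoly A p n = permPoly A' p' n := by
  constructor
  · intro h n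
    rcases eq_or_ne n 0 with rfl | hn
    · rw [permPoly_zero, permPoly_zero]
    · have h1 := congrArg (PowerSeries.coeff n) h
      simp only [permEGF, PowerSeries.coeff_mk, if_neg hn] at h1
      refine mul_left_cancel₀ ?_ h1
      rw [Ne, Polynomial.C_eq_zero]
      exact inv_ne_zero (by exact_mod_cast n.factorial_ne_zero)
  · intro h
    simp only [permEGF, h]

theorem stirlingPoly_zero (A : ℕ → Set Pattern) (p : ℕ → Pattern) : stirlingPoly A p 0 = 1 := by
  rw [stirlingPoly_eq]
  simp [permPoly_zero, partitionSum_zero_zero]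

theorem C_inv_factorial_ne_zero (n : ℕ) :
    (MvPolynomial.C ((n.factorial : ℚ)⁻¹) : LevelPoly) ≠ 0 := by
  rw [Ne, MvPolynomial.C_eq_zero]
  exact inv_ne_zero (by exact_mod_cast n.factorial_ne_zero)

theorem stirlingEGF_eq_iff {A A' : ℕ → Set Pattern} {p p' : ℕ → Pattern} :
    stirlingEGF A p = stirlingEGF A' p' ↔ ∀ n, stirlingPoly A p n = stirlingPoly A' p' n := by
  constructor
  · intro h n
    rcases eq_or_ne n 0 with rfl | hn
    · rw [stirlingPoly_zero, stirlingPoly_zero]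
    · have h1 := congrArg (PowerSeries.coeff n) h
      simp only [stirlingEGF, PowerSeries.coeff_mk, if_neg hn] at h1
      exact mul_left_cancel₀ (C_inv_factorial_ne_zero n) h1
  · intro h
    simp only [stirlingEGF, h]

theorem toLevelPoly_injective : Function.Injective toLevelPoly := by
  intro q q' h
  have key : ∀ q : Polynomial ℚ, MvPolynomial.aeval (fun _ => Polynomial.X) (toLevelPoly q) = q :=
    fun q => by
      rw [toLevelPoly, ← Polynomial.aeval_algHom_apply, MvPolynomial.aeval_X,
        Polynomial.aeval_X_left_apply]
  rw [← key q, h, key]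

/-- Setting all `yᵢ` equal to zero leaves only the constant term of the generating function. -/
theorem aeval_stirlingPoly_eq_zero {R : Type*} [CommRing R] [Algebra ℚ R] {f : ℕ ⊕ ℕ → R}
    (hf : f (Sum.inr 0) = 0) (A : ℕ → Set Pattern) (p : ℕ → Pattern) {n : ℕ} (hn : n ≠ 0) :
    MvPolynomial.aeval f (stirlingPoly A p n) = 0 := by
  rw [stirlingPoly_eq, map_sum]
  refine Finset.sum_eq_zero fun m _ => ?_
  have h := map_partitionSum ((MvPolynomial.aeval f : LevelPoly →ₐ[ℚ] R) : LevelPoly →+* R) m n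
    fun k => MvPolynomial.X (Sum.inr 0) *
      shift (stirlingPoly (fun i => A (i + 1)) (fun i => p (i + 1)) k)
  simp only [RingHom.coe_coe] at h
  rw [map_mul, h]
  simp only [map_mul, MvPolynomial.aeval_X, hf, zero_mul]
  rcases eq_or_ne m 0 with rfl | hm
  · rw [partitionSum_zero_left hn, mul_zero]
  · rw [partitionSum_zero_right hm, mul_zero]

/-- The specialization `y₁ = 1`, `y₂ = y₃ = ⋯ = 0`. -/
noncomputable def specialize : LevelPoly →ₐ[ℚ] Polynomial ℚ :=
  MvPolynomial.aeval (Sum.elim (fun _ => Polynomial.X) fun i => if i = 0 then 1 else 0)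

theorem specialize_toLevelPoly (q : Polynomial ℚ) : specialize (toLevelPoly q) = q := by
  rw [specialize, toLevelPoly, ← Polynomial.aeval_algHom_apply, MvPolynomial.aeval_X,
    Sum.elim_inl, Polynomial.aeval_X_left_apply]

/-- The shift turns y₁ of the interior into y₂, which is specialized to `0`; so only empty interiors
remain. -/
theorem specialize_shift_stirlingPoly (A : ℕ → Set Pattern) (p : ℕ → Pattern) (k : ℕ) :
    specialize (shift (stirlingPoly A p k)) = if k = 0 then 1 else 0 := by
  split_ifs with hk
  · rw [hk, stirlingPoly_zero, map_one, map_one]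
  · rw [specialize, shift, MvPolynomial.aeval_rename]
    exact aeval_stirlingPoly_eq_zero (by simp) A p hk

/-- After specialization every part is a singleton, so only `m = n` contributes. The constant `r`
does not depend on `A` and `p`, so it cancels when two families are compared. -/
theorem exists_specialize_stirlingPoly (n : ℕ) : ∃ r : ℚ, r ≠ 0 ∧
    ∀ (A : ℕ → Set Pattern) (p : ℕ → Pattern),
      specialize (stirlingPoly A p n) = Polynomial.C r * permPoly (A 0) (p 0) n := by
  obtain ⟨N, hN, h⟩ := partitionSum_indicator n
  refine ⟨(n.factorial : ℚ)⁻¹ * N, mul_ne_zero (inv_ne_zero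
    (by exact_mod_cast n.factorial_ne_zero)) (by exact_mod_cast hN), fun A p => ?_⟩
  have h1 : ∀ m, specialize (partitionSum m n fun k => MvPolynomial.X (Sum.inr 0) *
      shift (stirlingPoly (fun i => A (i + 1)) (fun i => p (i + 1)) k)) =
      if m = n then (N : Polynomial ℚ) else 0 := by
    intro m
    rw [← h, ← RingHom.coe_coe specialize, map_partitionSum]
    simp only [RingHom.coe_coe, map_mul, specialize_shift_stirlingPoly]
    simp [specialize]
  rw [stirlingPoly_eq, map_sum, Finset.sum_eq_single n]
  · rw [map_mul, h1, if_pos rfl, map_mul, specialize_toLevelPoly, MvPolynomial.C_eq_algebraMap,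
      AlgHom.commutes, Polynomial.algebraMap_eq, map_mul, map_natCast]
    ring
  · intro m _ hm
    rw [map_mul, h1, if_neg hm, mul_zero]
  · intro hn
    simp at hn

theorem permPoly_eq_of_stirlingPoly_eq {A A' : ℕ → Set Pattern} {p p' : ℕ → Pattern} {n : ℕ}
    (h : stirlingPoly A p n = stirlingPoly A' p' n) :
    permPoly (A 0) (p 0) n = permPoly (A' 0) (p' 0) n := by
  obtain ⟨r, hr, hspec⟩ := exists_specialize_stirlingPoly n
  have h1 := congrArg specialize h
  rw [hspec, hspec] at h1
  exact mul_left_cancel₀ (Polynomial.C_ne_zero.2 hr) h1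

/-- In the coefficient of index `n + 1` of the composition formula, the interior coefficient of
index `n` occurs only for `m = 1`, linearly and with a nonzero factor. -/
theorem stirlingPoly_shift_eq {A A' : ℕ → Set Pattern} {p p' : ℕ → Pattern}
    (h : ∀ n, stirlingPoly A p n = stirlingPoly A' p' n) (hA : Pattern.single ∉ A 0) (n : ℕ) :
    stirlingPoly (fun i => A (i + 1)) (fun i => p (i + 1)) n =
      stirlingPoly (fun i => A' (i + 1)) (fun i => p' (i + 1)) n := by
  have hperm : ∀ m, permPoly (A 0) (p 0) m = permPoly (A' 0) (p' 0) m := fun m =>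
    permPoly_eq_of_stirlingPoly_eq (h m)
  induction n using Nat.strong_induction_on with
  | _ n ih =>
  have h1 := h (n + 1)
  rw [stirlingPoly_eq, stirlingPoly_eq A',
    ← Finset.add_sum_erase _ _ (show 1 ∈ Finset.range (n + 1 + 1) by simp),
    ← Finset.add_sum_erase _ _ (show 1 ∈ Finset.range (n + 1 + 1) by simp)] at h1
  -- Both sides now have the same outer coefficients and differ at most in the interior ones.
  simp only [← hperm] at h1
  -- For `m ≠ 1` only interior coefficients of index below `n` enter, so these terms agree by `ih`
  -- and cancel.
  rw [Finset.sum_congr rfl fun m hm => by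
    rw [partitionSum_congr_of_ne_one (Finset.ne_of_mem_erase hm) fun k hk => by
      rw [ih k (by omega)]]] at h1
  have h2 := add_right_cancel h1
  obtain ⟨N, hN, hone⟩ := partitionSum_one n
  rw [hone, hone] at h2
  have hne : toLevelPoly (permPoly (A 0) (p 0) 1) ≠ 0 := fun h0 =>
    permPoly_one_ne_zero hA (p 0) (toLevelPoly_injective (h0.trans (map_zero _).symm))
  have hN' : (N : LevelPoly) ≠ 0 := Nat.cast_ne_zero.2 hN
  have h3 := mul_left_cancel₀ (mul_ne_zero (C_inv_factorial_ne_zero 1) hne) h2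
  have h4 := mul_left_cancel₀ hN' h3
  exact shift_injective (mul_left_cancel₀ (MvPolynomial.X_ne_zero _) h4)

theorem stirlingPoly_eq_of_shift_eq {A A' : ℕ → Set Pattern} {p p' : ℕ → Pattern}
    (hperm : ∀ m, permPoly (A 0) (p 0) m = permPoly (A' 0) (p' 0) m)
    (h : ∀ n, stirlingPoly (fun i => A (i + 1)) (fun i => p (i + 1)) n =
      stirlingPoly (fun i => A' (i + 1)) (fun i => p' (i + 1)) n) (n : ℕ) :
    stirlingPoly A p n = stirlingPoly A' p' n := by
  rw [stirlingPoly_eq, stirlingPoly_eq A']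
  simp only [hperm, h]

theorem permPoly_eq_of_forall_stirlingPoly_eq (i : ℕ) {A A' : ℕ → Set Pattern}
    {p p' : ℕ → Pattern} (h : ∀ n, stirlingPoly A p n = stirlingPoly A' p' n)
    (hA : ∀ j < i, Pattern.single ∉ A j) (n : ℕ) :
    permPoly (A i) (p i) n = permPoly (A' i) (p' i) n := by
  induction i generalizing A A' p p' with
  | zero => exact permPoly_eq_of_stirlingPoly_eq (h n)
  | succ i ih =>
    exact ih (A := fun j => A (j + 1)) (A' := fun j => A' (j + 1)) (p := fun j => p (j + 1))
      (p' := fun j => p' (j + 1)) (stirlingPoly_shift_eq h (hA 0 (Nat.succ_pos i)))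
      fun j hj => hA (j + 1) (Nat.succ_lt_succ hj)

/-- Each step restores one level on top, passing from the sequences starting at `r + 1` to those
starting at `r`. -/
theorem stirlingPoly_eq_of_forall_permPoly_eq (r : ℕ) {A A' : ℕ → Set Pattern}
    {p p' : ℕ → Pattern} (hperm : ∀ i n, permPoly (A i) (p i) n = permPoly (A' i) (p' i) n)
    (h : ∀ n, stirlingPoly (fun i => A (r + i)) (fun i => p (r + i)) n =
      stirlingPoly (fun i => A' (r + i)) (fun i => p' (r + i)) n) (n : ℕ) :
    stirlingPoly A p n = stirlingPoly A' p' n := by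
  induction r generalizing n with
  | zero => simpa using h n
  | succ r ih =>
    refine ih (fun m => stirlingPoly_eq_of_shift_eq (A := fun i => A (r + i))
      (A' := fun i => A' (r + i)) (p := fun i => p (r + i)) (p' := fun i => p' (r + i))
      (hperm _) (fun n => ?_) m) n
    have := h n
    simp only [add_right_comm r 1] at this
    exact this

end Coefficients

end StirlingWord

theorem corollary3 (A A' : ℕ → Set Pattern) (p p' : ℕ → Pattern) :
    (stirlingEGF A p = stirlingEGF A' p' →
      ∀ i : ℕ, (∀ j < i, Pattern.single ∉ A j) →
        permEGF (A i) (p i) = permEGF (A' i) (p' i)) ∧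
    ((∀ i : ℕ, permEGF (A i) (p i) = permEGF (A' i) (p' i)) →
      (∃ r : ℕ, stirlingEGF (fun i => A (r + i)) (fun i => p (r + i)) =
        stirlingEGF (fun i => A' (r + i)) (fun i => p' (r + i))) →
      stirlingEGF A p = stirlingEGF A' p') := by
  simp only [StirlingWord.permEGF_eq_iff, StirlingWord.stirlingEGF_eq_iff]
  refine ⟨fun h i hA n => StirlingWord.permPoly_eq_of_forall_stirlingPoly_eq i h hA n, ?_⟩
  rintro hperm ⟨r, h⟩ n
  exact StirlingWord.stirlingPoly_eq_of_forall_permPoly_eq r hperm h n
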